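/- **Setting.** Let $\mathcal O\subset\mathbb R^3$ be a triangulated object: a closed set whose boundary is a finite union of nondegenerate triangles $\Delta_1,\dots,\Delta_N$, any two distinct ones meeting in the empty set, a vertex or an edge of the triangulation, such that each $\Delta_i$ has an outward unit normal $\mathbf n_i$ (near each relative interior point of $\Delta_i$, $\mathcal O$ is the half-space behind $\Delta_i$). Let $\Phi=\bigcup_i\operatorname{relint}\Delta_i$, let $\mathbf n(\mathbf x)$ be the outward normal at $\mathbf x\in\Phi$, let $\mu_{\partial\mathcal O}$ be the surface (area) measure on $\partial\mathcal O$, let $\sigma$ be the spherical measure on $\mathbb S^2$, and let $L^2[\partial\mathcal O]$ be the space of measurable, square-integrable functions $g:\partial\mathcal O\to\mathbb R$. Let $\rho:\partial\mathcal O\to(0,1]$ be a measurable albedo. Put $\nu(\mathbf x,\mathbf u)=1$ if $(\{\mathbf x\}+\mathbb R_+\mathbf u)\cap\mathcal O=\{\mathbf x\}$ and $0$ otherwise, and $V(\mathbf x,\mathbf x')=1$ if $[\mathbf x,\mathbf x']\cap\mathcal O=\{\mathbf x,\mathbf x'\}$ and $0$ otherwise. For $\mathbf x\in\Phi$ set $$\bar{\mathcal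 D}[\mathbf u](\mathbf x)=\rho(\mathbf x)\langle\mathbf n(\mathbf x),\mathbf u\rangle_+\,\nu(\mathbf x,\mathbf u),\qquad \mathcal D[f](\mathbf x)=\int_{\mathbb S^2}\bar{\mathcal D}[\mathbf u](\mathbf x)f(\mathbf u)\,d\sigma(\mathbf u),\qquad \mathcal T[g](\mathbf x)=\int\kappa(\mathbf x,\mathbf x')g(\mathbf x')\,d\mu_{\partial\mathcal O}(\mathbf x'),$$ $$\kappa(\mathbf x,\mathbf x')=\frac{\rho(\mathbf x)}{\pi}\,\frac{\langle\mathbf n(\mathbf x'),\mathbf x-\mathbf x'\rangle\langle\mathbf n(\mathbf x),\mathbf x'-\mathbf x\rangle}{\|\mathbf x-\mathbf x'\|^4}\,V(\mathbf x,\mathbf x'),$$ and let all three functions be $0$ on $\partial\mathcal O\setminus\Phi$. The camera has its centre at the origin and optical axis $\mathbf e_3$, and the object lies in front of it: $\langle\mathbf e_3,\mathbf x\rangle>0$ for all $\mathbf x\in\mathcal O$. It has focal length $f_c>0$, lens diameter $d_c>0$, gain $\gamma_c>0$, and $m$ square pixels $I_1,\dots,I_m\subset\mathbb R^2$ of side $s_c>0$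 with disjoint interiors. Let $\mathfrak p(\mathbf x)\in\mathbb R^2$ consist of the first two coordinates of $-f_c\,\mathbf x/\langle\mathbf x,\mathbf e_3\rangle$, for $\mathbf x$ in the visible part $\partial\mathcal O_+=\{\mathbf x\in\partial\mathcal O:\operatorname{conv}\{\mathbf x,\mathbf 0\}\cap\mathcal O=\{\mathbf x\}\}$ of the boundary; $\mathfrak p$ is injective on $\partial\mathcal O_+$. Define $\mathcal P[g]=(\mathcal P_1[g],\dots,\mathcal P_m[g])\in\mathbb R^m$ by $$\mathcal P_i[g]=\frac{\gamma_c}{4}\Big(\frac{d_c}{f_c}\Big)^2\int_{I_i\cap\operatorname{im}\mathfrak p}g(\mathfrak p^{-1}(\mathbf z))\Big\langle\frac{\mathbf z}{\|\mathbf z\|_2},\mathbf e_3\Big\rangle^4d\mathbf z,$$ where inside the inner product and the norm $\mathbf z=(z_1,z_2)$ is read as the point $(z_1,z_2,-f_c)$ of the image plane. A function $f:\mathbb S^2\to\mathbb R$ is called Riemann integrable if $f(\eta(\theta,\phi))\sin\phi$ is Riemann integrable on $W=[0,2\pi]\times[0,\pi]$, where $\eta(\theta,\phi)=(\cos\theta\sin\phi,\sin\theta\sin\phi,\cos\phi)$;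 then $\int f(\mathbf u)\,d\mathbf u$ denotes the Riemann integral of $f(\eta(\theta,\phi))\sin\phi$ over $W$. **Lemma.** Suppose that $\|\mathcal T\|_{L^2\to L^2}<1$. Then $\mathcal I-\mathcal T$ is a bijection of $L^2[\partial\mathcal O]$ onto itself, the integrals that define $\mathcal P$ on $L^2[\partial\mathcal O]$ converge absolutely, and $\bar{\mathcal D}[\mathbf u]\in L^2[\partial\mathcal O]$ for every $\mathbf u\in\mathbb S^2$. For every Riemann integrable $f:\mathbb S^2\to\mathbb R$, the integrals that define $\mathcal D[f]$ converge absolutely and $\mathcal D[f]\in L^2[\partial\mathcal O]$, and the image $\mathbf y[f]=\mathcal P(\mathcal I-\mathcal T)^{-1}\mathcal D[f]$ satisfies $$\mathbf y[f]=\int\bar{\mathbf y}[\mathbf u]\,f(\mathbf u)\,d\mathbf u,\qquad \bar{\mathbf y}[\mathbf u]=\mathcal P(\mathcal I-\mathcal T)^{-1}\bar{\mathcal D}[\mathbf u],$$ where each coordinate of the integrand is Riemann integrable and the integral is a Riemann integral, taken coordinate by coordinate. -/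

import Mathlib

open MeasureTheory Metric Set
open scoped ENNReal

noncomputable section

/-- The space `ℝ³` of object points. -/
abbrev E3 : Type := EuclideanSpace ℝ (Fin 3)

/-- The plane `ℝ²` of image coordinates. -/
abbrev E2 : Type := EuclideanSpace ℝ (Fin 2)

/-- The unit sphere of light directions. -/
abbrev S2 : Type := sphere (0 : E3) 1

/-! ### Riemann integration on the sphere, in spherical coordinates -/

/-- `η(θ, φ) = (cos θ sin φ, sin θ sin φ, cos φ)`, with `θ = w 0` and `φ = w 1`. -/
def sphCoord (w : Fin 2 → ℝ) : S2 :=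
  ⟨!₂[Real.cos (w 0) * Real.sin (w 1), Real.sin (w 0) * Real.sin (w 1), Real.cos (w 1)], by
    rw [mem_sphere_zero_iff_norm, EuclideanSpace.norm_eq, Real.sqrt_eq_one]
    simp only [Fin.sum_univ_three, Real.norm_eq_abs, sq_abs]
    simp
    nlinarith [Real.sin_sq_add_cos_sq (w 0), Real.sin_sq_add_cos_sq (w 1)]⟩

/-- The rectangle `W = [0, 2π] × [0, π]`. -/
def sphBox : BoxIntegral.Box (Fin 2) where
  lower := ![0, 0]
  upper := ![2 * Real.pi, Real.pi]
  lower_lt_upper i := by fin_cases i <;> simp [Real.pi_pos]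

/-- `f` has Riemann integral `a` over the sphere: `f(η(θ, φ)) sin φ` is Riemann integrable
on the rectangle `W` and its Riemann integral is `a`. -/
def HasSphereRiemannIntegral (f : S2 → ℝ) (a : ℝ) : Prop :=
  BoxIntegral.HasIntegral sphBox BoxIntegral.IntegrationParams.Riemann
    (fun w => f (sphCoord w) * Real.sin (w 1)) BoxIntegral.BoxAdditiveMap.volume a

/-- Riemann integrability of a function on the sphere. -/
def SphereRiemannIntegrable (f : S2 → ℝ) : Prop :=
  ∃ a, HasSphereRiemannIntegral f a

/-- The spherical measure. -/
def sphereMeasure : Measure S2 := (volume : Measure E3).toSphere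

/-! ### Triangulated objects -/

/-- A triangulated object: a closed set `𝒪 ⊆ ℝ³` whose boundary is a union of finitely many
nondegenerate triangles, any two of which meet in the empty set, a vertex or an edge of the
triangulation, each triangle having an outward normal. -/
structure TriangulatedObject where
  /-- the set of points of the object -/
  carrier : Set E3
  isClosed_carrier : IsClosed carrier
  /-- the number of faces -/
  N : ℕ
  /-- the three vertices of each face -/
  vertex : Fin N → Fin 3 → E3
  affineIndependent_vertex : ∀ i, AffineIndependent ℝ (vertex i)
  frontier_eq : frontier carrier = ⋃ i, convexHull ℝ (range (vertex i))
  inter_faces : ∀ i j, i ≠ j →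
    convexHull ℝ (range (vertex i)) ∩ convexHull ℝ (range (vertex j)) = ∅ ∨
    (∃ k a, convexHull ℝ (range (vertex i)) ∩ convexHull ℝ (range (vertex j)) =
      {vertex k a}) ∨
    (∃ k a b, a ≠ b ∧
      convexHull ℝ (range (vertex i)) ∩ convexHull ℝ (range (vertex j)) =
        segment ℝ (vertex k a) (vertex k b))
  /-- the outward unit normal of each face -/
  normal : Fin N → E3
  norm_normal : ∀ i, ‖normal i‖ = 1
  normal_orthogonal : ∀ i a b, inner ℝ (normal i) (vertex i a - vertex i b) = 0
  /-- The normal points out of the object: near each relative interior point of the face, the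
  object is the half-space that lies behind the face. -/
  outward_normal : ∀ i, ∀ x ∈ intrinsicInterior ℝ (convexHull ℝ (range (vertex i))),
    ∃ r > 0, ∀ y ∈ ball x r, (y ∈ carrier ↔ inner ℝ (normal i) (y - x) ≤ 0)

namespace TriangulatedObject

variable (O : TriangulatedObject)

/-- The triangle `Δ_i`. -/
def face (i : Fin O.N) : Set E3 := convexHull ℝ (range (O.vertex i))

/-- `Φ`, the union of the relative interiors of the faces. -/
def regular : Set E3 := ⋃ i, intrinsicInterior ℝ (O.face i)

open Classical in
/-- The outward normal `n(x)` at a point `x ∈ Φ` (and `0` at other points). -/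
def normalAt (x : E3) : E3 :=
  if h : ∃ i, x ∈ intrinsicInterior ℝ (O.face i) then O.normal h.choose else 0

open Classical in
/-- Point-direction visibility: `ν(x, u) = 1` iff `({x} + ℝ₊ u) ∩ 𝒪 = {x}`. -/
def visDir (x : E3) (u : S2) : ℝ :=
  if {y | ∃ t : ℝ, 0 ≤ t ∧ y = x + t • (u : E3)} ∩ O.carrier = {x} then 1 else 0

open Classical in
/-- Point-point visibility: `V(x, x') = 1` iff `[x, x'] ∩ 𝒪 = {x, x'}`. -/
def visPt (x x' : E3) : ℝ :=
  if segment ℝ x x' ∩ O.carrier = {x, x'} then 1 else 0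

/-! ### Integration on the boundary -/

lemma finrank_vectorSpan_vertex (i : Fin O.N) :
    Module.finrank ℝ (vectorSpan ℝ (range (O.vertex i))) = 2 :=
  (O.affineIndependent_vertex i).finrank_vectorSpan (by simp)

/-- An orthonormal basis of the direction of the plane of `Δ_i`. -/
def faceBasis (i : Fin O.N) :
    OrthonormalBasis (Fin 2) ℝ (vectorSpan ℝ (range (O.vertex i))) :=
  (stdOrthonormalBasis ℝ _).reindex (finCongr (O.finrank_vectorSpan_vertex i))

/-- The isometric chart `φ_i(w) = z_i + B_i w` of the plane of `Δ_i`. -/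
def chart (i : Fin O.N) (w : E2) : E3 :=
  O.vertex i 0 + ((O.faceBasis i).repr.symm w : E3)

/-- The surface measure of the boundary: the sum over the faces of the Lebesgue measure of
`U_i = φ_i⁻¹(relint Δ_i)`, transported by `φ_i`. -/
def surfaceMeasure : Measure E3 :=
  ∑ i, ((volume : Measure E2).restrict
    (O.chart i ⁻¹' intrinsicInterior ℝ (O.face i))).map (O.chart i)

/-- `L²[∂𝒪]`, a space of functions. They are written as functions on `ℝ³`; only the values on
the boundary matter. -/
def L2 : Set (E3 → ℝ) := {g | MemLp g 2 O.surfaceMeasure}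

/-! ### Reflectance -/

/-- An albedo: a measurable function `∂𝒪 → (0, 1]`. Measurability is with respect to the
Lebesgue measurable sets of the faces, that is, up to null sets of the surface measure. -/
structure IsAlbedo (ρ : E3 → ℝ) : Prop where
  pos : ∀ x ∈ frontier O.carrier, 0 < ρ x
  le_one : ∀ x ∈ frontier O.carrier, ρ x ≤ 1
  aemeasurable : AEMeasurable ρ O.surfaceMeasure

open Classical in
/-- Direct reflectance under point illumination,
`D̄[u](x) = ρ(x) ⟨n(x), u⟩₊ ν(x, u)` on `Φ` and `0` elsewhere. -/
def pointDirect (ρ : E3 → ℝ) (u : S2) (x : E3) : ℝ :=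
  if x ∈ O.regular then ρ x * max (inner ℝ (O.normalAt x) (u : E3)) 0 * O.visDir x u else 0

/-- The direct illumination operator `D[f](x) = ∫ D̄[u](x) f(u) dσ(u)`. -/
def direct (ρ : E3 → ℝ) (f : S2 → ℝ) (x : E3) : ℝ :=
  ∫ u, O.pointDirect ρ u x * f u ∂sphereMeasure

/-- The interreflection kernel `κ(x, x')`. -/
def kernel (ρ : E3 → ℝ) (x x' : E3) : ℝ :=
  ρ x / Real.pi *
    (inner ℝ (O.normalAt x') (x - x') * inner ℝ (O.normalAt x) (x' - x) / ‖x - x'‖ ^ 4) *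
    O.visPt x x'

open Classical in
/-- The interreflection operator `T`. -/
def interreflection (ρ : E3 → ℝ) (g : E3 → ℝ) (x : E3) : ℝ :=
  if x ∈ O.regular then ∫ x', O.kernel ρ x x' * g x' ∂O.surfaceMeasure else 0

/-- The operator norm `‖T‖` from `L²` to `L²`, as the supremum of `‖T g‖` over the unit ball
(it is `∞` when `T` is not a bounded operator). -/
def interreflectionNorm (ρ : E3 → ℝ) : ℝ≥0∞ :=
  ⨆ g ∈ {g : E3 → ℝ | g ∈ O.L2 ∧ eLpNorm g 2 O.surfaceMeasure ≤ 1},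
    eLpNorm (O.interreflection ρ g) 2 O.surfaceMeasure

/-- The operator `I - T`. -/
def idSubInterreflection (ρ : E3 → ℝ) (g : E3 → ℝ) : E3 → ℝ :=
  fun x => g x - O.interreflection ρ g x

/-- The inverse `(I - T)⁻¹` of `I - T` on `L²[∂𝒪]`. -/
def resolvent (ρ : E3 → ℝ) : (E3 → ℝ) → (E3 → ℝ) :=
  Function.invFunOn (O.idSubInterreflection ρ) O.L2

end TriangulatedObject

/-! ### The camera -/

/-- `S` is a closed square of side length `s` in the plane (in any position). -/
def IsPlaneSquare (s : ℝ) (S : Set E2) : Prop :=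
  ∃ e : E2 ≃ᵢ E2, S = e '' {z | ∀ k, z k ∈ Icc 0 s}

/-- A perspective camera with centre at the origin and optical axis `e₃`, whose sensor consists
of `m` non-overlapping square pixels. -/
structure Camera (m : ℕ) where
  /-- focal length `f_c` -/
  focal : ℝ
  focal_pos : 0 < focal
  /-- lens diameter `d_c` -/
  lens : ℝ
  lens_pos : 0 < lens
  /-- camera gain `γ_c` -/
  gain : ℝ
  gain_pos : 0 < gain
  /-- side length `s_c` of the pixels -/
  side : ℝ
  side_pos : 0 < side
  /-- the pixels `I_i`, in image coordinates -/
  pixel : Fin m → Set E2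
  pixel_square : ∀ i, IsPlaneSquare side (pixel i)
  pixel_disjoint : ∀ i j, i ≠ j → Disjoint (interior (pixel i)) (interior (pixel j))

/-- The part `∂𝒪₊` of the boundary that the camera sees: `conv {x, 0} ∩ 𝒪 = {x}`. -/
def TriangulatedObject.visible (O : TriangulatedObject) : Set E3 :=
  {x | x ∈ frontier O.carrier ∧ segment ℝ x 0 ∩ O.carrier = {x}}

namespace Camera

variable {m : ℕ} (C : Camera m)

/-- Perspective projection: the first two coordinates of `-f_c x / ⟨x, e₃⟩`. -/
def proj (x : E3) : E2 := !₂[-C.focal * x 0 / x 2, -C.focal * x 1 / x 2]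

/-- The inverse of the perspective projection of the visible part of the object. -/
def projInv (O : TriangulatedObject) : E2 → E3 := Function.invFunOn C.proj O.visible

/-- The point of the image plane `{x₃ = -f_c}` in `ℝ³` with image coordinates `z`. -/
def imagePoint (z : E2) : E3 := !₂[z 0, z 1, -C.focal]

/-- `⟨z / ‖z‖, e₃⟩`, with `z` regarded as a point of the image plane. -/
def cosAngle (z : E2) : ℝ :=
  inner ℝ ((‖C.imagePoint z‖)⁻¹ • C.imagePoint z) (EuclideanSpace.single (2 : Fin 3) (1 : ℝ))

/-- The integrand `g(𝔭⁻¹(z)) ⟨z / ‖z‖, e₃⟩⁴` of the sensor model. -/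
def integrand (O : TriangulatedObject) (g : E3 → ℝ) (z : E2) : ℝ :=
  g (C.projInv O z) * C.cosAngle z ^ 4

/-- The part `I_i ∩ im 𝔭` of a pixel that is met by the image of the object. -/
def litPixel (O : TriangulatedObject) (i : Fin m) : Set E2 := C.pixel i ∩ C.proj '' O.visible

/-- The sensor operator `P`, which maps a radiosity to an image. -/
def sensor (O : TriangulatedObject) (g : E3 → ℝ) : EuclideanSpace ℝ (Fin m) :=
  WithLp.toLp 2 fun i =>
    C.gain / 4 * (C.lens / C.focal) ^ 2 * ∫ z in C.litPixel O i, C.integrand O g z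

/-- The imaging operator `y[f] = P (I - T)⁻¹ D[f]`. -/
def image (O : TriangulatedObject) (ρ : E3 → ℝ) (f : S2 → ℝ) : EuclideanSpace ℝ (Fin m) :=
  C.sensor O (O.resolvent ρ (O.direct ρ f))

/-- The image under point illumination, `ȳ[u] = P (I - T)⁻¹ D̄[u]`. -/
def pointImage (O : TriangulatedObject) (ρ : E3 → ℝ) (u : S2) : EuclideanSpace ℝ (Fin m) :=
  C.sensor O (O.resolvent ρ (O.pointDirect ρ u))

end Camera

end

/-!
# Images are superpositions of point-source images

The value of a pixel is a continuous linear functional of the radiosity. Since `‖T‖ < 1`, the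
operator `I - T` is invertible on the Hilbert space of square-integrable classes by the Neumann
series; it is bijective on functions because `T g` depends, at every point, only on the class of
`g`. The operator `T` is linear because its integrals converge: the kernel `κ(x, ·)` is bounded for
each `x ∈ Φ`, as a face does not illuminate itself. In front of the camera the perspective projection restricted to a face has a bounded Jacobian
determinant and is injective on visible points, so the change of variables formula bounds the
sensor by the `L¹` norm of the radiosity. By the Riesz representation theorem there is, for each
pixel, a function `h` with `(P (I - T)⁻¹ g)_i = ∫ h g dμ` for all `g`
(`Camera.exists_pixel_response`).

With `g = D[f]`, Fubini's theorem gives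
`y_i[f] = ∫ (∫ h D̄[u] dμ) f(u) dσ(u) = ∫ ȳ_i[u] f(u) dσ(u)`. It remains to see that the last
integral is a Riemann integral, and this holds because `ȳ_i` is *continuous* on the sphere. For a
fixed `u`, the function `D̄[·](x)` is continuous at `u` for almost every `x`
(`TriangulatedObject.ae_continuousAt_pointDirect`): in the plane of a face the shadow that another
face casts in the direction `u` is a convex set, off the relative boundary of this shadow (a null
set) the visibility is locally constant in the direction, and where `⟨n(x), u⟩ ≤ 0` the cosine
factor vanishes in the limit. Dominated convergence concludes.

A Riemann integrable function is bounded and almost everywhere continuous, hence so is its product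
with a continuous function, which is therefore Riemann integrable with its Lebesgue integral as
value (`RiemannBox.hasIntegral_mul_of_continuous`). The spherical measure is identified with
`sin φ dθ dφ` by the change of variables formula for spherical coordinates in space
(`SphericalCoordinates.sphereMeasure_eq_map`).
-/

noncomputable section

/-! ### Riemann integrable functions on boxes -/

namespace RiemannBox

open BoxIntegral Filter Topology
open scoped NNReal

lemma Icc_eq_closure {ι : Type} (J : Box ι) : Box.Icc J = closure (J : Set (ι → ℝ)) := by
  rw [Box.coe_eq_pi, closure_pi_set, Box.Icc_eq_pi]
  simp only [closure_Ioc (J.lower_ne_upper _)]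

lemma exists_mem_Icc {ι : Type} {I : Box ι} {π : Prepartition I} (hπ : π.IsPartition) {x : ι → ℝ}
    (hx : x ∈ Box.Icc I) : ∃ J ∈ π, x ∈ Box.Icc J := by
  have hcl : IsClosed (⋃ J ∈ π.boxes, Box.Icc J) :=
    π.boxes.finite_toSet.isClosed_biUnion fun J _ => J.isCompact_Icc.isClosed
  have hsub : (I : Set (ι → ℝ)) ⊆ ⋃ J ∈ π.boxes, Box.Icc J := by
    intro y hy
    obtain ⟨J, hJ, hyJ⟩ := hπ y hy
    exact mem_biUnion hJ (Box.coe_subset_Icc hyJ)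
  rw [Icc_eq_closure] at hx
  simpa using closure_minimal hsub hcl hx

variable {ι : Type} [Fintype ι] {I : Box ι} {F : (ι → ℝ) → ℝ} {a : ℝ}

/-- Cauchy criterion: on a suitable fine partition, moving the tags changes the Riemann sum by
at most `ε`. -/
lemma exists_partition_abs_sum_sub_le
    (h : HasIntegral I IntegrationParams.Riemann F BoxAdditiveMap.volume a) {ε : ℝ} (hε : 0 < ε) :
    ∃ π : Prepartition I, π.IsPartition ∧ ∀ s t : Box ι → ι → ℝ,
      (∀ J ∈ π, s J ∈ Box.Icc J) → (∀ J ∈ π, t J ∈ Box.Icc J) →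
      |∑ J ∈ π.boxes, volume.real (J : Set (ι → ℝ)) * (F (s J) - F (t J))| ≤ ε := by
  classical
  obtain ⟨r, hr, H⟩ := hasIntegral_iff.1 h (ε / 2) (half_pos hε)
  set c := I.distortion
  set δ : ℝ := ((r c 0 : Ioi (0 : ℝ)) : ℝ) with hδ
  have hδ0 : 0 < δ := (r c 0).2
  -- half the radius, so that the partition stays subordinate to `δ` for every choice of tags
  obtain ⟨π, hπ, hpart⟩ := IntegrationParams.Riemann.exists_memBaseSet_isPartition I le_rfl
    (fun _ => ⟨δ / 2, half_pos hδ0⟩)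
  refine ⟨π.toPrepartition, hpart, ?_⟩
  have key : ∀ s : Box ι → ι → ℝ, (∀ J ∈ π.toPrepartition, s J ∈ Box.Icc J) →
      |∑ J ∈ π.boxes, volume.real (J : Set (ι → ℝ)) * F (s J) - a| ≤ ε / 2 := by
    intro s hs
    let π' : TaggedPrepartition I :=
      { π.toPrepartition with
        tag := fun J => if J ∈ π.boxes then s J else I.lower
        tag_mem_Icc := fun J => by
          split_ifs with hJ
          · exact (Box.le_iff_Icc.1 (π.le_of_mem' J hJ)) (hs J hJ)
          · exact I.lower_mem_Icc }
    have htag : ∀ J ∈ π.boxes, π'.tag J = s J := fun J hJ => if_pos hJ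
    have hmem : IntegrationParams.Riemann.MemBaseSet I c (r c) π' := by
      refine ⟨fun J hJ x hx => ?_, fun _ J hJ => ?_, fun hD => ?_, fun hD => ?_⟩
      · have h1 := hπ.isSubordinate J hJ hx
        have h2 := hπ.isSubordinate J hJ (hs J hJ)
        rw [htag J hJ, hr c rfl, mem_closedBall]
        rw [mem_closedBall] at h1 h2
        calc dist x (s J) ≤ dist x (π.tag J) + dist (s J) (π.tag J) := dist_triangle_right _ _ _
          _ ≤ δ / 2 + δ / 2 := add_le_add h1 h2
          _ = r c 0 := by rw [add_halves]
      · rw [htag J hJ]; exact hs J hJ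
      · cases hD
      · cases hD
    have := H c π' hmem hpart
    rw [Real.dist_eq] at this
    convert this using 3
    refine Finset.sum_congr rfl fun J hJ => ?_
    rw [htag J hJ]; rfl
  intro s t hs ht
  have h1 := key s hs
  have h2 := key t ht
  simp only [mul_sub, Finset.sum_sub_distrib]
  rw [abs_le] at *
  constructor <;> linarith [h1.1, h1.2, h2.1, h2.2]

lemma volume_real_pos (J : Box ι) : 0 < volume.real (J : Set (ι → ℝ)) := by
  rw [measureReal_def, Box.volume_apply']
  exact Finset.prod_pos fun i _ => sub_pos.2 (J.lower_lt_upper i)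

/-- A Riemann integrable function is bounded. -/
lemma exists_abs_le (h : HasIntegral I IntegrationParams.Riemann F BoxAdditiveMap.volume a) :
    ∃ C : ℝ, ∀ x ∈ Box.Icc I, |F x| ≤ C := by
  classical
  obtain ⟨π, hπ, H⟩ := exists_partition_abs_sum_sub_le h one_pos
  refine ⟨∑ J ∈ π.boxes, (|F J.lower| + 1 / volume.real (J : Set (ι → ℝ))), fun x hx => ?_⟩
  obtain ⟨J, hJ, hxJ⟩ := exists_mem_Icc hπ hx
  have h1 := H (Function.update (fun J => J.lower) J x) (fun J => J.lower) (fun K hK => by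
    by_cases hKJ : K = J
    · subst hKJ; simpa using hxJ
    · simp [Function.update_of_ne hKJ]) (fun K _ => K.lower_mem_Icc)
  rw [Finset.sum_eq_single_of_mem J hJ fun K _ hKJ => by simp [Function.update_of_ne hKJ]] at h1
  have hv := volume_real_pos J
  rw [Function.update_self, abs_mul, abs_of_pos hv, mul_comm, ← le_div_iff₀ hv] at h1
  have h2 : |F x| ≤ |F J.lower| + 1 / volume.real (J : Set (ι → ℝ)) := by
    have := abs_sub_abs_le_abs_sub (F x) (F J.lower)
    linarith
  refine h2.trans (Finset.single_le_sum
    (f := fun J : Box ι => |F J.lower| + 1 / volume.real (J : Set (ι → ℝ))) (fun K _ => ?_) hJ)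
  have := volume_real_pos K
  positivity

/-- The points of a box near which the oscillation of a Riemann integrable function is at least
`α` form a null set. -/
lemma volume_oscillation_eq_zero
    (h : HasIntegral I IntegrationParams.Riemann F BoxAdditiveMap.volume a) {α : ℝ} (hα : 0 < α) :
    volume {x | x ∈ (I : Set (ι → ℝ)) ∧ ∀ U ∈ 𝓝 x, ∃ y ∈ U, ∃ z ∈ U, α ≤ F y - F z} = 0 := by
  classical
  refine nonpos_iff_eq_zero.1 (ENNReal.le_of_forall_pos_le_add fun ε hε _ => ?_)
  rw [zero_add]
  obtain ⟨π, hπ, H⟩ := exists_partition_abs_sum_sub_le h (ε := ε * α) (by positivity)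
  let bad : Box ι → Prop := fun J => ∃ y ∈ Box.Icc J, ∃ z ∈ Box.Icc J, α ≤ F y - F z
  choose! s hs t ht hst using fun (J : Box ι) (hJ : bad J) => hJ
  have hsum : ∑ J ∈ π.boxes with bad J, volume.real (J : Set (ι → ℝ)) ≤ ε := by
    have h1 := (abs_le.1 (H (fun J => if bad J then s J else J.lower)
      (fun J => if bad J then t J else J.lower)
      (fun J _ => by split_ifs with hb; exacts [hs J hb, J.lower_mem_Icc])
      (fun J _ => by split_ifs with hb; exacts [ht J hb, J.lower_mem_Icc]))).2
    refine le_of_mul_le_mul_right (le_trans ?_ h1) hα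
    rw [Finset.sum_mul, Finset.sum_filter]
    refine Finset.sum_le_sum fun J _ => ?_
    split_ifs with hb
    · exact mul_le_mul_of_nonneg_left (hst J hb) measureReal_nonneg
    · simp
  have hsub : {x | x ∈ (I : Set (ι → ℝ)) ∧ ∀ U ∈ 𝓝 x, ∃ y ∈ U, ∃ z ∈ U, α ≤ F y - F z} ⊆
      (⋃ J ∈ π.boxes.filter bad, (J : Set (ι → ℝ))) ∪
        ⋃ J ∈ π.boxes, (Box.Icc J \ Box.Ioo J) := by
    rintro x ⟨hxI, hx⟩
    obtain ⟨J, hJ, hxJ⟩ := hπ x hxI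
    by_cases hxo : x ∈ Box.Ioo J
    · left
      have hopen : IsOpen (Box.Ioo J) := isOpen_set_pi finite_univ fun _ _ => isOpen_Ioo
      obtain ⟨y, hy, z, hz, hyz⟩ := hx _ (hopen.mem_nhds hxo)
      refine mem_biUnion (Finset.mem_coe.2 (Finset.mem_filter.2 ⟨hJ, y, ?_, z, ?_, hyz⟩)) hxJ
      exacts [Box.Ioo_subset_Icc J hy, Box.Ioo_subset_Icc J hz]
    · right
      exact mem_biUnion (Finset.mem_coe.2 hJ) ⟨Box.coe_subset_Icc hxJ, hxo⟩
  have hnull : volume (⋃ J ∈ π.boxes, (Box.Icc J \ Box.Ioo J) : Set (ι → ℝ)) = 0 := by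
    refine (measure_biUnion_null_iff π.boxes.countable_toSet).2 fun J _ => ?_
    exact (ae_le_set.1 (Box.Ioo_ae_eq_Icc J).symm.le)
  calc volume {x | x ∈ (I : Set (ι → ℝ)) ∧ ∀ U ∈ 𝓝 x, ∃ y ∈ U, ∃ z ∈ U, α ≤ F y - F z}
      ≤ volume (⋃ J ∈ π.boxes.filter bad, (J : Set (ι → ℝ))) + 0 := by
        rw [← hnull]; exact (measure_mono hsub).trans (measure_union_le _ _)
    _ ≤ ∑ J ∈ π.boxes with bad J, volume (J : Set (ι → ℝ)) := by
        rw [add_zero]; exact measure_biUnion_finset_le _ _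
    _ = ENNReal.ofReal (∑ J ∈ π.boxes with bad J, volume.real (J : Set (ι → ℝ))) := by
        rw [ENNReal.ofReal_sum_of_nonneg fun _ _ => measureReal_nonneg]
        exact Finset.sum_congr rfl fun J _ =>
          (ofReal_measureReal (J.measure_coe_lt_top volume).ne).symm
    _ ≤ ε := by
        rw [← ENNReal.ofReal_coe_nnreal]; exact ENNReal.ofReal_le_ofReal hsum

/-- A Riemann integrable function is continuous almost everywhere. -/
lemma ae_continuousAt (h : HasIntegral I IntegrationParams.Riemann F BoxAdditiveMap.volume a) :
    ∀ᵐ x, x ∈ (I : Set (ι → ℝ)) → ContinuousAt F x := by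
  have h1 : ∀ᵐ x, ∀ n : ℕ, ¬ (x ∈ (I : Set (ι → ℝ)) ∧
      ∀ U ∈ 𝓝 x, ∃ y ∈ U, ∃ z ∈ U, 1 / ((n : ℝ) + 1) ≤ F y - F z) := by
    refine ae_all_iff.2 fun n => ?_
    rw [ae_iff]
    simpa only [not_not] using volume_oscillation_eq_zero h (α := 1 / ((n : ℝ) + 1))
      (by positivity)
  filter_upwards [h1] with x hx hxI
  rw [Metric.continuousAt_iff']
  intro ε hε
  obtain ⟨n, hn⟩ := exists_nat_one_div_lt hε
  have := hx n
  push Not at this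
  obtain ⟨U, hU, hyz⟩ := this hxI
  filter_upwards [hU] with y hy
  rw [Real.dist_eq, abs_lt]
  have h2 := hyz y hy x (mem_of_mem_nhds hU)
  have h3 := hyz x (mem_of_mem_nhds hU) y hy
  constructor <;> linarith

/-- The product of a continuous function and a Riemann integrable function is Riemann integrable,
and its Riemann integral is its Lebesgue integral. -/
theorem hasIntegral_mul_of_continuous
    (h : HasIntegral I IntegrationParams.Riemann F BoxAdditiveMap.volume a)
    {c : (ι → ℝ) → ℝ} (hc : Continuous c) :
    HasIntegral I IntegrationParams.Riemann (fun x => c x * F x) BoxAdditiveMap.volume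
      (∫ x in I, c x * F x) := by
  classical
  obtain ⟨C, hC⟩ := exists_abs_le h
  obtain ⟨D, hD⟩ := I.isCompact_Icc.exists_bound_of_continuousOn hc.continuousOn
  -- truncation outside the closed box makes the function continuous almost everywhere
  set G : (ι → ℝ) → ℝ := (Box.Icc I).indicator fun x => c x * F x with hG
  have hGb : ∃ K : ℝ, ∀ x ∈ Box.Icc I, ‖G x‖ ≤ K := by
    refine ⟨D * C, fun x hx => ?_⟩
    rw [hG, indicator_of_mem hx, norm_mul]
    exact mul_le_mul (hD x hx) (hC x hx) (norm_nonneg _) ((norm_nonneg _).trans (hD x hx))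
  have hGc : ∀ᵐ x, ContinuousAt G x := by
    have hfr : ∀ᵐ x : ι → ℝ, ¬ (x ∈ Box.Icc I \ Box.Ioo I) := by
      rw [ae_iff]
      simpa only [not_not] using! (ae_le_set.1 (Box.Ioo_ae_eq_Icc I).symm.le)
    filter_upwards [hfr, ae_continuousAt h] with x hx hcont
    by_cases hxI : x ∈ Box.Icc I
    · have hxo : x ∈ Box.Ioo I := by by_contra hxo; exact hx ⟨hxI, hxo⟩
      have hopen : IsOpen (Box.Ioo I) := isOpen_set_pi finite_univ fun _ _ => isOpen_Ioo
      have : G =ᶠ[𝓝 x] fun x => c x * F x := by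
        filter_upwards [hopen.mem_nhds hxo] with y hy
        rw [hG, indicator_of_mem (Box.Ioo_subset_Icc I hy)]
      exact (hc.continuousAt.mul (hcont (Box.Ioo_subset_coe I hxo))).congr this.symm
    · have : G =ᶠ[𝓝 x] fun _ => 0 := by
        filter_upwards [I.isCompact_Icc.isClosed.isOpen_compl.mem_nhds hxI] with y hy
        rw [hG, indicator_of_notMem hy]
      exact continuousAt_const.congr this.symm
  have := AEContinuous.hasBoxIntegral volume hGb hGc IntegrationParams.Riemann
  have hint : ∫ x in I, G x = ∫ x in I, c x * F x :=
    setIntegral_congr_fun I.measurableSet_coe fun x hx => by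
      rw [hG, indicator_of_mem (Box.coe_subset_Icc hx)]
  rw [hint] at this
  have heq : EqOn G (fun x => c x * F x) (Box.Icc I) := fun x hx => by
    rw [hG, indicator_of_mem hx]
  exact (hasIntegral_congr I _ heq (fun _ _ => rfl) _).1 this

/-- A Riemann integrable function is Lebesgue integrable. -/
theorem integrableOn (h : HasIntegral I IntegrationParams.Riemann F BoxAdditiveMap.volume a) :
    IntegrableOn F I := by
  obtain ⟨C, hC⟩ := exists_abs_le h
  have : AEStronglyMeasurable F (volume.restrict (I : Set (ι → ℝ))) := by
    let v := {x : (ι → ℝ) | ContinuousAt F x}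
    have hv : AEStronglyMeasurable F (volume.restrict v) :=
      (continuousOn_of_forall_continuousAt fun _ h ↦ h).aestronglyMeasurable
      (measurableSet_of_continuousAt F)
    refine hv.mono_ac ?_
    have : (I : Set (ι → ℝ)) ≤ᵐ[volume] v := ae_continuousAt h
    exact Measure.absolutelyContinuous_of_le (Measure.restrict_mono' this le_rfl)
  exact IntegrableOn.of_bound (I.measure_coe_lt_top volume) this C
    ((ae_restrict_iff' I.measurableSet_coe).2 (ae_of_all _ fun x hx =>
      hC x (Box.coe_subset_Icc hx)))

end RiemannBox

/-! ### The spherical measure in spherical coordinates -/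

namespace SphericalCoordinates

open Real
open scoped Pointwise

lemma sphCoord_apply_zero (w : Fin 2 → ℝ) : (sphCoord w : E3) 0 = cos (w 0) * sin (w 1) := rfl
lemma sphCoord_apply_one (w : Fin 2 → ℝ) : (sphCoord w : E3) 1 = sin (w 0) * sin (w 1) := rfl
lemma sphCoord_apply_two (w : Fin 2 → ℝ) : (sphCoord w : E3) 2 = cos (w 1) := rfl

lemma mem_Ioo_sphBox {w : Fin 2 → ℝ} :
    w ∈ BoxIntegral.Box.Ioo sphBox ↔ (0 < w 0 ∧ w 0 < 2 * π) ∧ 0 < w 1 ∧ w 1 < π := by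
  change w ∈ Set.univ.pi (fun i => Ioo (sphBox.lower i) (sphBox.upper i)) ↔ _
  simp [sphBox, Set.mem_pi, Fin.forall_fin_two]

lemma continuous_sphCoord : Continuous sphCoord := by
  refine Continuous.subtype_mk ?_ _
  refine (PiLp.continuous_toLp 2 _).comp (continuous_pi fun i => ?_)
  fin_cases i <;> simp <;> fun_prop

lemma eq_of_cos_eq_of_sin_eq {a b : ℝ} (ha : 0 < a ∧ a < 2 * π) (hb : 0 < b ∧ b < 2 * π)
    (hc : cos a = cos b) (hs : sin a = sin b) : a = b := by
  have h := Real.Angle.cos_sin_inj hc hs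
  rw [Real.Angle.angle_eq_iff_two_pi_dvd_sub] at h
  obtain ⟨k, hk⟩ := h
  have hpi := Real.pi_pos
  have h1 : (k : ℝ) < 1 := by nlinarith
  have h2 : (-1 : ℝ) < k := by nlinarith
  have h1' : k < 1 := by exact_mod_cast h1
  have h2' : -1 < k := by exact_mod_cast h2
  have : k = 0 := by omega
  rw [this] at hk
  simp at hk
  linarith

lemma injOn_sphCoord : InjOn sphCoord (BoxIntegral.Box.Ioo sphBox) := by
  intro w hw v hv h
  rw [mem_Ioo_sphBox] at hw hv
  have h0 : (sphCoord w : E3) 0 = (sphCoord v : E3) 0 := by rw [h]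
  have h1 : (sphCoord w : E3) 1 = (sphCoord v : E3) 1 := by rw [h]
  have h2 : (sphCoord w : E3) 2 = (sphCoord v : E3) 2 := by rw [h]
  rw [sphCoord_apply_zero, sphCoord_apply_zero] at h0
  rw [sphCoord_apply_one, sphCoord_apply_one] at h1
  rw [sphCoord_apply_two, sphCoord_apply_two] at h2
  have e1 : w 1 = v 1 := injOn_cos ⟨hw.2.1.le, hw.2.2.le⟩ ⟨hv.2.1.le, hv.2.2.le⟩ h2
  have hs : sin (v 1) ≠ 0 := (sin_pos_of_pos_of_lt_pi hv.2.1 hv.2.2).ne'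
  rw [e1] at h0 h1
  have e0 : w 0 = v 0 := eq_of_cos_eq_of_sin_eq hw.1 hv.1 (mul_right_cancel₀ hs h0)
    (mul_right_cancel₀ hs h1)
  ext i
  fin_cases i
  exacts [e0, e1]

/-- The open parameter rectangle covers the sphere up to a great circle. -/
lemma exists_sphCoord_eq (u : S2) (hu : (u : E3) 1 ≠ 0) :
    ∃ w ∈ BoxIntegral.Box.Ioo sphBox, sphCoord w = u := by
  have hn : (u : E3) 0 ^ 2 + (u : E3) 1 ^ 2 + (u : E3) 2 ^ 2 = 1 := by
    have := mem_sphere_zero_iff_norm.1 u.2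
    rw [EuclideanSpace.norm_eq, Real.sqrt_eq_one] at this
    simpa [Fin.sum_univ_three] using this
  have hpos : 0 < (u : E3) 1 ^ 2 := by positivity
  set ψ := arccos ((u : E3) 2) with hψ
  have hlt : (u : E3) 2 ^ 2 < 1 := by nlinarith [sq_nonneg ((u : E3) 0)]
  have hlt' := abs_lt.1 ((sq_lt_one_iff_abs_lt_one _).1 hlt)
  have hcos : cos ψ = (u : E3) 2 := cos_arccos hlt'.1.le hlt'.2.le
  have hψ0 : 0 < ψ := arccos_pos.2 hlt'.2
  have hψπ : ψ < π := by
    refine lt_of_le_of_ne (arccos_le_pi _) fun h => ?_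
    rw [h, cos_pi] at hcos
    linarith
  have hsin : 0 < sin ψ := sin_pos_of_pos_of_lt_pi hψ0 hψπ
  have hss : sin ψ ^ 2 = (u : E3) 0 ^ 2 + (u : E3) 1 ^ 2 := by
    rw [sin_sq, hcos]; linarith
  -- the argument of the opposite point is shifted by `π` into `(0, 2π)`
  set z : ℂ := ⟨-(u : E3) 0, -(u : E3) 1⟩ with hz
  have hz0 : z ≠ 0 := fun h => hu (by simpa [hz] using congrArg Complex.im h)
  have hnz : ‖z‖ = sin ψ := by
    have hsq : Complex.normSq z = sin ψ ^ 2 := by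
      rw [hss, Complex.normSq_apply, hz]; ring
    rw [Complex.norm_def, hsq, Real.sqrt_sq hsin.le]
  have hargne : z.arg ≠ π := fun h => hu (by
    have := (Complex.arg_eq_pi_iff.1 h).2
    simpa [hz] using this)
  have harg : z.arg < π := lt_of_le_of_ne (Complex.arg_le_pi z) hargne
  refine ⟨![z.arg + π, ψ], mem_Ioo_sphBox.2 ⟨⟨?_, ?_⟩, hψ0, hψπ⟩, ?_⟩
  · have := Complex.neg_pi_lt_arg z
    simp; linarith
  · simp; linarith
  · ext i
    fin_cases i
    · change cos (z.arg + π) * sin ψ = (u : E3) 0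
      rw [cos_add_pi, Complex.cos_arg hz0, hnz]
      field_simp; simp [hz]
    · change sin (z.arg + π) * sin ψ = (u : E3) 1
      rw [sin_add_pi, Complex.sin_arg, hnz]
      field_simp; simp [hz]
    · exact hcos

/-- The angles `(θ, φ)` of a triple `(r, θ, φ)`. -/
def angles (p : E3) : Fin 2 → ℝ := fun i => p i.succ

/-- Spherical coordinates `(r, θ, φ) ↦ r η(θ, φ)` in space. -/
def polar (p : E3) : E3 := p 0 • (sphCoord (angles p) : E3)

/-- The Jacobian matrix of spherical coordinates. -/
def polarJacobian (p : E3) : Matrix (Fin 3) (Fin 3) ℝ :=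
  !![cos (p 1) * sin (p 2), -(p 0 * sin (p 1) * sin (p 2)), p 0 * cos (p 1) * cos (p 2);
     sin (p 1) * sin (p 2), p 0 * cos (p 1) * sin (p 2), p 0 * sin (p 1) * cos (p 2);
     cos (p 2), 0, -(p 0 * sin (p 2))]

/-- The derivative of spherical coordinates. -/
def polarDeriv (p : E3) : E3 →L[ℝ] E3 :=
  LinearMap.toContinuousLinearMap (Matrix.toLin (EuclideanSpace.basisFun (Fin 3) ℝ).toBasis
    (EuclideanSpace.basisFun (Fin 3) ℝ).toBasis (polarJacobian p))

lemma polarDeriv_apply (p v : E3) (i : Fin 3) :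
    polarDeriv p v i = ∑ j, polarJacobian p i j * v j := by
  simp [polarDeriv, Matrix.toLin_apply, Matrix.mulVec, dotProduct, Finset.sum_apply,
    Pi.single_apply]

lemma det_polarDeriv (p : E3) : (polarDeriv p).det = -(p 0 ^ 2 * sin (p 2)) := by
  rw [ContinuousLinearMap.det, polarDeriv, LinearMap.coe_toContinuousLinearMap,
    LinearMap.det_toLin, polarJacobian, Matrix.det_fin_three]
  simp
  have h1 := sin_sq_add_cos_sq (p 1)
  have h2 := sin_sq_add_cos_sq (p 2)
  have e1 : sin (p 1) ^ 2 = 1 - cos (p 1) ^ 2 := by linarith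
  have e2 : sin (p 2) ^ 2 = 1 - cos (p 2) ^ 2 := by linarith
  ring_nf
  simp only [e1, show sin (p 2) ^ 3 = sin (p 2) * (1 - cos (p 2) ^ 2) by rw [← e2]; ring]
  ring

lemma hasFDerivAt_polar (p : E3) : HasFDerivAt polar (polarDeriv p) p := by
  rw [← hasFDerivWithinAt_univ, hasFDerivWithinAt_euclidean]
  intro i
  rw [hasFDerivWithinAt_univ]
  have h (i : Fin 3) : HasFDerivAt (fun p : E3 => p i) (EuclideanSpace.proj i : E3 →L[ℝ] ℝ) p :=
    (EuclideanSpace.proj i : E3 →L[ℝ] ℝ).hasFDerivAt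
  fin_cases i
  · refine ((h 0).mul ((h 1).cos.mul (h 2).sin)).congr_fderiv ?_
    ext v
    simp [polarDeriv_apply, polarJacobian, Fin.sum_univ_three]
    ring
  · refine ((h 0).mul ((h 1).sin.mul (h 2).sin)).congr_fderiv ?_
    ext v
    simp [polarDeriv_apply, polarJacobian, Fin.sum_univ_three]
    ring
  · refine ((h 0).mul ((h 2).cos)).congr_fderiv ?_
    ext v
    simp [polarDeriv_apply, polarJacobian, Fin.sum_univ_three]
    ring

lemma measurable_angles : Measurable angles :=
  measurable_pi_lambda _ fun i => by unfold angles; fun_prop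

/-- The triples `(r, θ, φ)` with `0 < r < 1` and directions in `s`. -/
def polarDomain (s : Set S2) : Set E3 :=
  {p | p 0 ∈ Ioo (0 : ℝ) 1 ∧ angles p ∈ BoxIntegral.Box.Ioo sphBox ∩ sphCoord ⁻¹' s}

lemma measurableSet_polarDomain {s : Set S2} (hs : MeasurableSet s) :
    MeasurableSet (polarDomain s) := by
  have h0 : Measurable fun p : E3 => p 0 := by fun_prop
  exact (h0 measurableSet_Ioo).inter (measurable_angles
    ((BoxIntegral.Box.measurableSet_Ioo _).inter (continuous_sphCoord.measurable hs)))

lemma injOn_polar (s : Set S2) : InjOn polar (polarDomain s) := by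
  rintro p ⟨hp0, hp, -⟩ q ⟨hq0, hq, -⟩ h
  have hn (p : E3) (hp : p 0 ∈ Ioo (0 : ℝ) 1) : ‖polar p‖ = p 0 := by
    rw [polar, norm_smul, mem_sphere_zero_iff_norm.1 (sphCoord (angles p)).2, mul_one,
      Real.norm_of_nonneg hp.1.le]
  have h0 : p 0 = q 0 := by rw [← hn p hp0, ← hn q hq0, h]
  have h1 : angles p = angles q := by
    refine injOn_sphCoord hp hq (Subtype.ext ?_)
    rw [polar, polar, h0] at h
    exact smul_right_injective _ hq0.1.ne' h
  ext i
  refine Fin.cases h0 (fun j => ?_) i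
  exact congrFun h1 j

/-- The cone over a subset of the sphere is, up to a subset of a plane, the image of its parameters
under spherical coordinates. -/
lemma polar_image_ae_eq (s : Set S2) :
    (volume : Measure E3) (Ioo (0 : ℝ) 1 • ((↑) '' s : Set E3)) =
      volume (polar '' polarDomain s) := by
  refine le_antisymm ?_ (measure_mono ?_)
  · have hnull : (volume : Measure E3) {x | x 1 = 0} = 0 := by
      have := Measure.addHaar_submodule (volume : Measure E3)
        (LinearMap.ker (EuclideanSpace.proj 1 : E3 →L[ℝ] ℝ).toLinearMap) (fun h => by
          have h1 : (EuclideanSpace.single (1 : Fin 3) (1 : ℝ)) ∈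
            LinearMap.ker (EuclideanSpace.proj 1 : E3 →L[ℝ] ℝ).toLinearMap := by
              rw [h]; trivial
          simp at h1)
      exact this
    refine (measure_mono (t := polar '' polarDomain s ∪ {x | x 1 = 0}) ?_).trans
      ((measure_union_le _ _).trans (by rw [hnull, add_zero]))
    rintro _ ⟨r, hr, _, ⟨u, hu, rfl⟩, rfl⟩
    by_cases h1 : (u : E3) 1 = 0
    · right; simp [h1]
    · left
      obtain ⟨w, hw, rfl⟩ := exists_sphCoord_eq u h1
      have ha : angles !₂[r, w 0, w 1] = w := by
        ext i; fin_cases i <;> rfl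
      refine ⟨!₂[r, w 0, w 1], ⟨hr, ?_⟩, ?_⟩
      · rw [ha]; exact ⟨hw, hu⟩
      · rw [polar, ha]; rfl
  · rintro _ ⟨p, ⟨hp0, hp1, hp2⟩, rfl⟩
    exact ⟨p 0, hp0, _, ⟨_, hp2, rfl⟩, rfl⟩

lemma measurePreserving_split :
    MeasurePreserving (fun p : E3 => (p 0, angles p)) volume
      ((volume : Measure ℝ).prod (volume : Measure (Fin 2 → ℝ))) :=
  (volume_preserving_piFinSuccAbove (fun _ : Fin 3 => ℝ) 0).comp (PiLp.volume_preserving_ofLp _)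

/-- The spherical measure in spherical coordinates. -/
theorem sphereMeasure_eq_map :
    sphereMeasure = Measure.map sphCoord ((volume.restrict (BoxIntegral.Box.Ioo sphBox)).withDensity
      fun w => ENNReal.ofReal (sin (w 1))) := by
  ext s hs
  have hS : MeasurableSet (sphCoord ⁻¹' s) := continuous_sphCoord.measurable hs
  have hW := BoxIntegral.Box.measurableSet_Ioo sphBox
  rw [Measure.map_apply continuous_sphCoord.measurable hs, withDensity_apply _ hS,
    Measure.restrict_restrict hS, inter_comm, sphereMeasure, Measure.toSphere_apply' _ hs,
    polar_image_ae_eq, ← lintegral_abs_det_fderiv_eq_addHaar_image volume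
      (measurableSet_polarDomain hs) (fun p _ => (hasFDerivAt_polar p).hasFDerivWithinAt)
      (injOn_polar s)]
  have h1 : ∫⁻ p in polarDomain s, ENNReal.ofReal |(polarDeriv p).det| =
      ∫⁻ p : E3, (fun z : ℝ × (Fin 2 → ℝ) => (Ioo (0 : ℝ) 1).indicator
        (fun r => ENNReal.ofReal (r ^ 2)) z.1 *
        (BoxIntegral.Box.Ioo sphBox ∩ sphCoord ⁻¹' s).indicator
          (fun w => ENNReal.ofReal (sin (w 1))) z.2) (p 0, angles p) := by
    rw [← lintegral_indicator (measurableSet_polarDomain hs)]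
    refine lintegral_congr fun p => ?_
    by_cases hp0 : p 0 ∈ Ioo (0 : ℝ) 1
    · by_cases hp1 : angles p ∈ BoxIntegral.Box.Ioo sphBox ∩ sphCoord ⁻¹' s
      · have hsin : 0 ≤ sin (p 2) := by
          have := (mem_Ioo_sphBox.1 hp1.1).2
          exact (sin_pos_of_pos_of_lt_pi this.1 this.2).le
        rw [indicator_of_mem (show p ∈ polarDomain s from ⟨hp0, hp1⟩)]
        simp only [indicator_of_mem hp0, indicator_of_mem hp1]
        rw [← ENNReal.ofReal_mul (by positivity), det_polarDeriv, abs_neg,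
          abs_of_nonneg (by positivity)]
        rfl
      · rw [indicator_of_notMem (fun h : p ∈ polarDomain s => hp1 h.2)]
        simp [indicator_of_notMem hp1]
    · rw [indicator_of_notMem (fun h : p ∈ polarDomain s => hp0 h.1)]
      simp only [indicator_of_notMem hp0, zero_mul]
  have m1 : Measurable ((Ioo (0 : ℝ) 1).indicator (fun r : ℝ => ENNReal.ofReal (r ^ 2))) :=
    (by fun_prop : Measurable fun r : ℝ => ENNReal.ofReal (r ^ 2)).indicator measurableSet_Ioo
  have m2 : Measurable ((BoxIntegral.Box.Ioo sphBox ∩ sphCoord ⁻¹' s).indicator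
          (fun w => ENNReal.ofReal (sin (w 1)))) :=
    (by fun_prop : Measurable fun w : Fin 2 → ℝ => ENNReal.ofReal (sin (w 1))).indicator
      (hW.inter hS)
  have h3 := h1.trans ((measurePreserving_split.lintegral_comp
    ((m1.comp measurable_fst).mul (m2.comp measurable_snd))).trans
    (lintegral_prod_mul m1.aemeasurable m2.aemeasurable))
  rw [h3, lintegral_indicator measurableSet_Ioo, lintegral_indicator (hW.inter hS)]
  -- the radial integral cancels the dimension in the definition of the spherical measure
  have h2 : ∫⁻ r in Ioo (0 : ℝ) 1, ENNReal.ofReal (r ^ 2) = ENNReal.ofReal (1 / 3) := by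
    rw [restrict_Ioo_eq_restrict_Ioc, ← ofReal_integral_eq_lintegral_ofReal]
    · rw [← intervalIntegral.integral_of_le zero_le_one, integral_pow]; norm_num
    · exact (continuous_pow 2).integrableOn_Ioc
    · exact ae_of_all _ fun _ => sq_nonneg _
  rw [h2, ← mul_assoc, show ((Module.finrank ℝ E3 : ℕ) : ℝ≥0∞) * ENNReal.ofReal (1 / 3) = 1 by
    rw [finrank_euclideanSpace_fin, ← ENNReal.ofReal_natCast, ← ENNReal.ofReal_mul (by positivity)]
    norm_num, one_mul]

/-- The measure `sin φ dθ dφ` on the open parameter rectangle. -/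
def parameterMeasure : Measure (Fin 2 → ℝ) :=
  (volume.restrict (BoxIntegral.Box.Ioo sphBox)).withDensity fun w => ENNReal.ofReal (sin (w 1))

lemma integrable_sphere_iff_parameter (f : S2 → ℝ) :
    Integrable f sphereMeasure ↔ Integrable (f ∘ sphCoord) parameterMeasure := by
  have hW := BoxIntegral.Box.measurableSet_Ioo sphBox
  have he := continuous_sphCoord.continuousOn.measurableEmbedding hW injOn_sphCoord
  have hν : parameterMeasure = Measure.map (Subtype.val : BoxIntegral.Box.Ioo sphBox → _)
      (Measure.comap Subtype.val parameterMeasure) := by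
    rw [map_comap_subtype_coe hW, parameterMeasure, restrict_withDensity hW,
      Measure.restrict_restrict hW, inter_self]
  have hσ : sphereMeasure = Measure.map ((BoxIntegral.Box.Ioo sphBox).domRestrict sphCoord)
      (Measure.comap Subtype.val parameterMeasure) := by
    rw [sphereMeasure_eq_map]
    change Measure.map sphCoord parameterMeasure = _
    conv_lhs => rw [hν, Measure.map_map continuous_sphCoord.measurable measurable_subtype_coe]
    rfl
  conv_rhs => rw [hν]
  rw [hσ, he.integrable_map_iff, (MeasurableEmbedding.subtype_coe hW).integrable_map_iff]
  rfl

lemma integrable_parameter_iff (g : (Fin 2 → ℝ) → ℝ) :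
    Integrable g parameterMeasure ↔
      IntegrableOn (fun w => g w * sin (w 1)) (BoxIntegral.Box.Ioo sphBox) := by
  rw [parameterMeasure, integrable_withDensity_iff_integrable_smul' (by fun_prop)
    (ae_of_all _ fun _ => ENNReal.ofReal_lt_top)]
  refine integrable_congr ((ae_restrict_iff' (BoxIntegral.Box.measurableSet_Ioo _)).2
    (ae_of_all _ fun w hw => ?_))
  have := (mem_Ioo_sphBox.1 hw).2
  beta_reduce
  rw [ENNReal.toReal_ofReal (sin_pos_of_pos_of_lt_pi this.1 this.2).le, smul_eq_mul, mul_comm]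

lemma Ioo_ae_eq_coe : BoxIntegral.Box.Ioo sphBox =ᵐ[volume] (sphBox : Set (Fin 2 → ℝ)) :=
  (BoxIntegral.Box.Ioo_ae_eq_Icc _).trans (BoxIntegral.Box.coe_ae_eq_Icc _).symm

/-- Integrability on the sphere in spherical coordinates. -/
theorem integrable_sphere_iff (f : S2 → ℝ) : Integrable f sphereMeasure ↔
    IntegrableOn (fun w => f (sphCoord w) * sin (w 1)) sphBox := by
  rw [integrable_sphere_iff_parameter, integrable_parameter_iff,
    integrableOn_congr_set_ae Ioo_ae_eq_coe]
  rfl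

/-- Integration on the sphere in spherical coordinates. -/
theorem integral_sphere {f : S2 → ℝ} (hf : Integrable f sphereMeasure) :
    ∫ u, f u ∂sphereMeasure = ∫ w in sphBox, f (sphCoord w) * sin (w 1) := by
  have hf' := hf.aestronglyMeasurable
  rw [sphereMeasure_eq_map] at hf' ⊢
  rw [integral_map continuous_sphCoord.aemeasurable hf',
    integral_withDensity_eq_integral_toReal_smul (by fun_prop)
    (ae_of_all _ fun _ => ENNReal.ofReal_lt_top), ← setIntegral_congr_set Ioo_ae_eq_coe]
  refine setIntegral_congr_fun (BoxIntegral.Box.measurableSet_Ioo _) fun w hw => ?_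
  have := (mem_Ioo_sphBox.1 hw).2
  rw [ENNReal.toReal_ofReal (sin_pos_of_pos_of_lt_pi this.1 this.2).le, smul_eq_mul, mul_comm]

end SphericalCoordinates

/-! ### Measurability of visibility -/

lemma isClosed_exists_mem {X : Type*} [TopologicalSpace X] {K : Set ℝ} (hK : IsCompact K)
    {A : Set E3} (hA : IsClosed A) {G : X × ℝ → E3} (hG : Continuous G) :
    IsClosed {p | ∃ t ∈ K, G (p, t) ∈ A} := by
  have : CompactSpace K := isCompact_iff_compactSpace.1 hK
  have h1 : IsClosed {q : X × K | G (q.1, (q.2 : ℝ)) ∈ A} :=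
    hA.preimage (hG.comp (by fun_prop : Continuous fun q : X × K => (q.1, (q.2 : ℝ))))
  convert isClosedMap_fst_of_compactSpace _ h1 using 1
  ext p
  simp

/-- Meeting a closed set for some parameter in `U` is a Borel condition, since a locally closed set
of parameters is a countable union of compact sets. -/
lemma measurableSet_exists_mem {X : Type*} [TopologicalSpace X] [MeasurableSpace X] [BorelSpace X]
    {U : Set ℝ} (hU : IsLocallyClosed U) {A : Set E3} (hA : IsClosed A) {G : X × ℝ → E3}
    (hG : Continuous G) : MeasurableSet {p | ∃ t ∈ U, G (p, t) ∈ A} := by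
  have : LocallyCompactSpace U := hU.locallyCompactSpace
  obtain ⟨K, hK, hKU⟩ := isSigmaCompact_iff_sigmaCompactSpace.2
    (sigmaCompactSpace_of_locallyCompact_secondCountable : SigmaCompactSpace U)
  have : {p | ∃ t ∈ U, G (p, t) ∈ A} = ⋃ n, {p | ∃ t ∈ K n, G (p, t) ∈ A} := by
    ext p
    simp only [← hKU, mem_ofPred_eq, mem_iUnion]
    constructor
    · rintro ⟨t, ⟨n, hn⟩, h⟩; exact ⟨n, t, hn, h⟩
    · rintro ⟨n, t, hn, h⟩; exact ⟨t, ⟨n, hn⟩, h⟩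
  rw [this]
  exact MeasurableSet.iUnion fun n => (isClosed_exists_mem (hK n) hA hG).measurableSet

namespace TriangulatedObject

variable (O : TriangulatedObject)

lemma frontier_subset_carrier : frontier O.carrier ⊆ O.carrier :=
  O.isClosed_carrier.frontier_subset

lemma visDir_eq (x : E3) (u : S2) : O.visDir x u =
    ({p : E3 × S2 | p.1 ∈ O.carrier} \
      {p | ∃ t ∈ Ioi (0 : ℝ), p.1 + t • (p.2 : E3) ∈ O.carrier}).indicator 1 (x, u) := by
  classical
  have hu : (u : E3) ≠ 0 := fun h => by
    have := mem_sphere_zero_iff_norm.1 u.2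
    rw [h, norm_zero] at this
    exact zero_ne_one this
  rw [visDir, indicator_apply]
  refine if_congr ?_ rfl rfl
  rw [Set.ext_iff]
  constructor
  · intro h
    refine ⟨((h x).2 rfl).2, ?_⟩
    rintro ⟨t, ht, hm⟩
    have := (h (x + t • (u : E3))).1 ⟨⟨t, (mem_Ioi.1 ht).le, rfl⟩, hm⟩
    rw [mem_singleton_iff, add_eq_left, smul_eq_zero] at this
    exact this.elim (mem_Ioi.1 ht).ne' hu
  · rintro ⟨hx, h⟩ y
    constructor
    · rintro ⟨⟨t, ht, rfl⟩, hm⟩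
      rcases ht.eq_or_lt with rfl | ht
      · simp
      · exact (h ⟨t, ht, hm⟩).elim
    · rintro rfl
      exact ⟨⟨0, le_rfl, by simp⟩, hx⟩

lemma measurable_visDir : Measurable fun p : E3 × S2 => O.visDir p.1 p.2 := by
  simp_rw [visDir_eq]
  refine measurable_one.indicator ((measurable_fst O.isClosed_carrier.measurableSet).diff ?_)
  exact measurableSet_exists_mem isOpen_Ioi.isLocallyClosed O.isClosed_carrier
    (G := fun q : (E3 × S2) × ℝ => q.1.1 + q.2 • (q.1.2 : E3)) (by fun_prop)

lemma visPt_eq (x x' : E3) : O.visPt x x' =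
    ({p : E3 × E3 | p.1 ∈ O.carrier} ∩ {p | p.2 ∈ O.carrier} ∩
      ({p | p.1 = p.2} ∪ {p | ∃ t ∈ Ioo (0 : ℝ) 1, p.1 + t • (p.2 - p.1) ∈ O.carrier}ᶜ)).indicator
        1 (x, x') := by
  classical
  rw [visPt, indicator_apply]
  refine if_congr ?_ rfl rfl
  rw [segment_eq_image', Set.ext_iff]
  constructor
  · intro h
    refine ⟨⟨((h x).2 (by simp)).2, ((h x').2 (by simp)).2⟩, ?_⟩
    by_cases hx : x = x'
    · exact Or.inl hx
    · right
      rintro ⟨t, ht, hm⟩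
      have hne : x' - x ≠ 0 := sub_ne_zero.2 (Ne.symm hx)
      rcases (h (x + t • (x' - x))).1 ⟨⟨t, Ioo_subset_Icc_self ht, rfl⟩, hm⟩ with h1 | h1
      · rw [add_eq_left, smul_eq_zero] at h1
        exact h1.elim ht.1.ne' hne
      · have h2 : (t - 1) • (x' - x) = 0 := by
          have h3 : t • (x' - x) = x' - x := eq_sub_of_add_eq' (mem_singleton_iff.1 h1)
          rw [sub_smul, one_smul, h3, sub_self]
        rw [smul_eq_zero] at h2
        exact h2.elim (sub_ne_zero.2 ht.2.ne) hne
  · rintro ⟨⟨hx, hx'⟩, h⟩ y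
    have hx : x ∈ O.carrier := hx
    have hx' : x' ∈ O.carrier := hx'
    constructor
    · rintro ⟨⟨t, ht, rfl⟩, hm⟩
      rcases h with h | h
      · have h : x = x' := h
        subst h; simp
      · rcases ht.1.eq_or_lt with h0 | h0
        · subst h0; simp
        · rcases ht.2.eq_or_lt with h1 | h1
          · subst h1; simp
          · exact (h ⟨t, ⟨h0, h1⟩, hm⟩).elim
    · rintro (rfl | h1)
      · exact ⟨⟨0, by simp, by simp⟩, hx⟩
      · rw [mem_singleton_iff] at h1
        subst h1
        exact ⟨⟨1, by simp, by simp⟩, hx'⟩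

lemma measurable_visPt : Measurable fun p : E3 × E3 => O.visPt p.1 p.2 := by
  simp_rw [visPt_eq]
  refine measurable_one.indicator (((measurable_fst O.isClosed_carrier.measurableSet).inter
    (measurable_snd O.isClosed_carrier.measurableSet)).inter (MeasurableSet.union ?_
      (MeasurableSet.compl ?_)))
  · exact measurableSet_eq_fun measurable_fst measurable_snd
  · exact measurableSet_exists_mem isOpen_Ioo.isLocallyClosed O.isClosed_carrier
      (G := fun q : (E3 × E3) × ℝ => q.1.1 + q.2 • (q.1.2 - q.1.1)) (by fun_prop)

lemma visDir_nonneg (x : E3) (u : S2) : 0 ≤ O.visDir x u := by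
  unfold visDir; split_ifs <;> norm_num

lemma visDir_le_one (x : E3) (u : S2) : O.visDir x u ≤ 1 := by
  unfold visDir; split_ifs <;> norm_num

lemma visPt_nonneg (x x' : E3) : 0 ≤ O.visPt x x' := by
  unfold visPt; split_ifs <;> norm_num

lemma visPt_le_one (x x' : E3) : O.visPt x x' ≤ 1 := by
  unfold visPt; split_ifs <;> norm_num

lemma visible_eq (hfront : ∀ x ∈ O.carrier, 0 < x 2) : O.visible =
    frontier O.carrier \ {x | ∃ t ∈ Ioc (0 : ℝ) 1, (1 - t) • x ∈ O.carrier} := by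
  ext x
  constructor
  · rintro ⟨hx, h⟩
    refine ⟨hx, ?_⟩
    rintro ⟨t, ht, hm⟩
    have : (1 - t) • x ∈ segment ℝ x 0 ∩ O.carrier := by
      refine ⟨⟨1 - t, t, by linarith [ht.2], ht.1.le, by ring, by simp⟩, hm⟩
    rw [h, mem_singleton_iff] at this
    have h2 := congrArg (fun y : E3 => y 2) this
    have hpos := hfront x (O.frontier_subset_carrier hx)
    have h3 : (1 - t) * x 2 = x 2 := h2
    nlinarith [ht.1, mul_pos ht.1 hpos]
  · rintro ⟨hx, h⟩
    refine ⟨hx, Subset.antisymm ?_ ?_⟩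
    · rintro y ⟨⟨a, b, ha, hb, hab, rfl⟩, hm⟩
      rcases hb.eq_or_lt with rfl | hb
      · simp at hab; simp [hab]
      · refine (h ⟨b, ⟨hb, by linarith⟩, ?_⟩).elim
        rw [smul_zero, add_zero] at hm
        rwa [← hab, add_sub_cancel_right]
    · rintro y rfl
      exact ⟨left_mem_segment _ _ _, O.frontier_subset_carrier hx⟩

lemma measurableSet_visible (hfront : ∀ x ∈ O.carrier, 0 < x 2) : MeasurableSet O.visible := by
  rw [O.visible_eq hfront]
  refine isClosed_frontier.measurableSet.diff ?_
  exact measurableSet_exists_mem (isOpen_Ioi.isLocallyClosed.inter isClosed_Iic.isLocallyClosed)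
    O.isClosed_carrier (G := fun q : E3 × ℝ => (1 - q.2) • q.1) (by fun_prop)

/-! ### The faces and their charts -/

lemma face_subset_frontier (i : Fin O.N) : O.face i ⊆ frontier O.carrier := by
  rw [O.frontier_eq]; exact subset_iUnion (fun i => O.face i) i

lemma relint_subset_face (i : Fin O.N) : intrinsicInterior ℝ (O.face i) ⊆ O.face i :=
  intrinsicInterior_subset (𝕜 := ℝ)

lemma relint_subset_regular (i : Fin O.N) : intrinsicInterior ℝ (O.face i) ⊆ O.regular :=
  subset_iUnion (fun i => intrinsicInterior ℝ (O.face i)) i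

lemma isCompact_face (i : Fin O.N) : IsCompact (O.face i) := by
  rw [face]; exact (finite_range _).isCompact_convexHull (𝕜 := ℝ)

lemma convex_face (i : Fin O.N) : Convex ℝ (O.face i) := convex_convexHull _ _

lemma measurableSet_relint (i : Fin O.N) : MeasurableSet (intrinsicInterior ℝ (O.face i)) := by
  have hc : IsClosed ((affineSpan ℝ (O.face i) : AffineSubspace ℝ E3) : Set E3) :=
    AffineSubspace.closed_of_finiteDimensional _
  rw [intrinsicInterior]
  exact (MeasurableEmbedding.subtype_coe hc.measurableSet).measurableSet_image.2
    isOpen_interior.measurableSet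

lemma measurableSet_regular : MeasurableSet O.regular :=
  MeasurableSet.iUnion O.measurableSet_relint

lemma normal_orthogonal_vectorSpan (i : Fin O.N) {v : E3}
    (hv : v ∈ vectorSpan ℝ (range (O.vertex i))) : inner ℝ (O.normal i) v = 0 := by
  have : vectorSpan ℝ (range (O.vertex i)) ≤
      LinearMap.ker (innerSL ℝ (O.normal i)).toLinearMap := by
    rw [vectorSpan_def, Submodule.span_le]
    rintro _ ⟨_, ⟨a, rfl⟩, _, ⟨b, rfl⟩, rfl⟩
    exact O.normal_orthogonal i a b
  exact this hv

lemma vectorSpan_eq (i : Fin O.N) :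
    vectorSpan ℝ (range (O.vertex i)) = (Submodule.span ℝ {O.normal i})ᗮ := by
  refine Submodule.eq_of_le_of_finrank_eq (fun v hv => ?_) ?_
  · rw [Submodule.mem_orthogonal_singleton_iff_inner_right]
    exact O.normal_orthogonal_vectorSpan i hv
  · have hn : O.normal i ≠ 0 := fun h => by
      have := O.norm_normal i
      rw [h, norm_zero] at this
      exact zero_ne_one this
    have h1 := Submodule.finrank_add_finrank_orthogonal (Submodule.span ℝ {O.normal i})
    rw [finrank_span_singleton hn, finrank_euclideanSpace_fin] at h1
    rw [O.finrank_vectorSpan_vertex]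
    omega

lemma chart_sub (i : Fin O.N) (w w' : E2) :
    O.chart i w - O.chart i w' = ((O.faceBasis i).repr.symm (w - w') : E3) := by
  simp [chart]

lemma isometry_chart (i : Fin O.N) : Isometry (O.chart i) := by
  refine Isometry.of_dist_eq fun w w' => ?_
  rw [dist_eq_norm, chart_sub, dist_eq_norm, ← Submodule.coe_norm, LinearIsometryEquiv.norm_map]

lemma continuous_chart (i : Fin O.N) : Continuous (O.chart i) := (O.isometry_chart i).continuous

lemma measurableEmbedding_chart (i : Fin O.N) : MeasurableEmbedding (O.chart i) :=
  (O.isometry_chart i).isClosedEmbedding.measurableEmbedding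

lemma exists_chart_eq_add (i : Fin O.N) (w : E2) {v : E3} (hv : inner ℝ (O.normal i) v = 0) :
    ∃ w', O.chart i w' = O.chart i w + v := by
  have hv' : v ∈ vectorSpan ℝ (range (O.vertex i)) := by
    rw [O.vectorSpan_eq, Submodule.mem_orthogonal_singleton_iff_inner_right]; exact hv
  refine ⟨w + (O.faceBasis i).repr ⟨v, hv'⟩, ?_⟩
  rw [chart, map_add, LinearIsometryEquiv.symm_apply_apply, Submodule.coe_add, chart, add_assoc]

lemma chart_range (i : Fin O.N) : range (O.chart i) = affineSpan ℝ (O.face i) := by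
  rw [face, affineSpan_convexHull]
  have h0 : O.vertex i 0 ∈ affineSpan ℝ (range (O.vertex i)) :=
    subset_affineSpan ℝ _ (mem_range_self 0)
  ext y
  constructor
  · rintro ⟨w, rfl⟩
    rw [chart, add_comm]
    exact AffineSubspace.vadd_mem_of_mem_direction
      (by rw [direction_affineSpan]; exact Subtype.prop _) h0
  · intro hy
    have hv : y - O.vertex i 0 ∈ vectorSpan ℝ (range (O.vertex i)) := by
      rw [← direction_affineSpan]; exact AffineSubspace.vsub_mem_direction hy h0
    refine ⟨(O.faceBasis i).repr ⟨_, hv⟩, ?_⟩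
    rw [chart, LinearIsometryEquiv.symm_apply_apply]
    simp

lemma exists_chart_eq (i : Fin O.N) {x : E3} (hx : x ∈ O.face i) : ∃ w, O.chart i w = x := by
  have : x ∈ range (O.chart i) := by
    rw [chart_range]; exact subset_affineSpan ℝ _ hx
  exact this

lemma chart_mem_relint (i : Fin O.N) {w : E2} (hw : w ∈ interior (O.chart i ⁻¹' O.face i)) :
    O.chart i w ∈ intrinsicInterior ℝ (O.face i) := by
  obtain ⟨r, hr, hball⟩ := Metric.mem_nhds_iff.1 (mem_interior_iff_mem_nhds.1 hw)
  have hmem : O.chart i w ∈ affineSpan ℝ (O.face i) := by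
    have := mem_range_self (f := O.chart i) w
    rwa [chart_range] at this
  refine mem_intrinsicInterior.2 ⟨⟨_, hmem⟩, ?_, rfl⟩
  refine mem_interior_iff_mem_nhds.2 (Metric.mem_nhds_iff.2 ⟨r, hr, ?_⟩)
  rintro ⟨y, hy⟩ hyr
  have hy' : y ∈ range (O.chart i) := by rw [chart_range]; exact hy
  obtain ⟨w', rfl⟩ := hy'
  refine hball ?_
  rw [mem_ball, Subtype.dist_eq, (O.isometry_chart i).dist_eq] at hyr
  exact hyr

lemma convex_preimage_chart (i : Fin O.N) {A : Set E3} (hA : Convex ℝ A) :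
    Convex ℝ (O.chart i ⁻¹' A) := by
  intro w hw w' hw' a b ha hb hab
  have : O.chart i (a • w + b • w') = a • O.chart i w + b • O.chart i w' := by
    simp only [chart, map_add, map_smul, Submodule.coe_add, Submodule.coe_smul, smul_add]
    nth_rewrite 1 [show O.vertex i 0 = a • O.vertex i 0 + b • O.vertex i 0 by
      rw [← add_smul, hab, one_smul]]
    module
  rw [mem_preimage, this]
  exact hA hw hw' ha hb hab

/-- The relative boundary of a face is a null set, being contained in the frontier of a convex set
in the parameter plane. -/
lemma volume_preimage_face_diff_relint (i : Fin O.N) :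
    volume (O.chart i ⁻¹' (O.face i \ intrinsicInterior ℝ (O.face i))) = 0 := by
  refine measure_mono_null ?_
    ((O.convex_preimage_chart i (O.convex_face i)).addHaar_frontier volume)
  intro w hw
  exact ⟨subset_closure hw.1, fun h => hw.2 (O.chart_mem_relint i h)⟩

/-! ### Normals -/

/-- The half-space condition determines the normal. -/
lemma eq_of_halfspace {A : Set E3} {x n n' : E3} (hn : ‖n‖ = 1) (hn' : ‖n'‖ = 1)
    (h : ∃ r > 0, ∀ y ∈ ball x r, (y ∈ A ↔ inner ℝ n (y - x) ≤ 0))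
    (h' : ∃ r > 0, ∀ y ∈ ball x r, (y ∈ A ↔ inner ℝ n' (y - x) ≤ 0)) : n = n' := by
  obtain ⟨r, hr, h⟩ := h
  obtain ⟨r', hr', h'⟩ := h'
  by_contra hne
  have hc : inner ℝ n n' < 1 := inner_lt_one_iff_real_of_norm_eq_one hn hn' |>.2 hne
  -- moving from `x` along `n' - n` enters the half-space of `n` and leaves that of `n'`
  obtain ⟨t, ht, htr⟩ : ∃ t : ℝ, 0 < t ∧ t * ‖n' - n‖ < min r r' := by
    have : 0 < min r r' := lt_min hr hr'
    refine ⟨min r r' / (‖n' - n‖ + 1), by positivity, ?_⟩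
    rw [div_mul_eq_mul_div, div_lt_iff₀ (by positivity)]
    nlinarith [norm_nonneg (n' - n)]
  have hy : dist (x + t • (n' - n)) x < min r r' := by
    rw [dist_eq_norm, add_sub_cancel_left, norm_smul, Real.norm_of_nonneg ht.le]; exact htr
  have h1 := h _ (lt_of_lt_of_le hy (min_le_left _ _))
  have h2 := h' _ (lt_of_lt_of_le hy (min_le_right _ _))
  rw [h1] at h2
  simp only [add_sub_cancel_left, inner_smul_right, inner_sub_right, real_inner_self_eq_norm_sq,
    hn, hn', real_inner_comm n n'] at h2
  have h3 := h2.1 (by nlinarith)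
  nlinarith [mul_pos ht (sub_pos.2 hc), real_inner_comm n n']

/-- The normal at a point does not depend on the face chosen in its definition. -/
lemma normalAt_eq (i : Fin O.N) {x : E3} (hx : x ∈ intrinsicInterior ℝ (O.face i)) :
    O.normalAt x = O.normal i := by
  classical
  have h : ∃ i, x ∈ intrinsicInterior ℝ (O.face i) := ⟨i, hx⟩
  rw [normalAt, dif_pos h]
  exact eq_of_halfspace (O.norm_normal _) (O.norm_normal _)
    (O.outward_normal _ _ h.choose_spec) (O.outward_normal _ _ hx)

lemma normalAt_of_notMem {x : E3} (hx : x ∉ O.regular) : O.normalAt x = 0 := by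
  classical
  rw [normalAt, dif_neg]
  simpa [regular] using hx

lemma norm_normalAt_le (x : E3) : ‖O.normalAt x‖ ≤ 1 := by
  by_cases hx : x ∈ O.regular
  · obtain ⟨i, hi⟩ := mem_iUnion.1 hx
    rw [O.normalAt_eq i hi, O.norm_normal]
  · rw [O.normalAt_of_notMem hx]; simp

lemma measurable_normalAt : Measurable O.normalAt := by
  classical
  intro s _
  have : O.normalAt ⁻¹' s = (⋃ i, if O.normal i ∈ s then intrinsicInterior ℝ (O.face i) else ∅) ∪
      (if (0 : E3) ∈ s then O.regularᶜ else ∅) := by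
    ext x
    by_cases hx : x ∈ O.regular
    · obtain ⟨i, hi⟩ := mem_iUnion.1 hx
      have h2 : x ∉ (if (0 : E3) ∈ s then O.regularᶜ else ∅) := by
        split_ifs
        · exact fun h => h hx
        · exact notMem_empty x
      simp only [mem_preimage, mem_union, h2, or_false, mem_iUnion]
      constructor
      · intro h
        refine ⟨i, ?_⟩
        rw [O.normalAt_eq i hi] at h
        rwa [if_pos h]
      · rintro ⟨j, hj⟩
        split_ifs at hj with hjs
        · rwa [O.normalAt_eq j hj]
        · exact hj.elim
    · have h1 : x ∉ ⋃ i, if O.normal i ∈ s then intrinsicInterior ℝ (O.face i) else ∅ := by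
        rw [mem_iUnion]
        rintro ⟨j, hj⟩
        split_ifs at hj with hjs
        · exact hx (O.relint_subset_regular j hj)
        · exact hj.elim
      simp only [mem_preimage, mem_union, h1, false_or, O.normalAt_of_notMem hx]
      split_ifs with h
      · simp [h, hx]
      · simp [h]
  rw [this]
  refine (MeasurableSet.iUnion fun i => ?_).union ?_
  · split_ifs
    exacts [O.measurableSet_relint i, MeasurableSet.empty]
  · split_ifs
    exacts [O.measurableSet_regular.compl, MeasurableSet.empty]

/-! ### The surface measure -/

instance isFiniteMeasure_surfaceMeasure : IsFiniteMeasure O.surfaceMeasure := by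
  refine ⟨?_⟩
  rw [surfaceMeasure, Measure.finsetSum_apply]
  refine ENNReal.sum_lt_top.2 fun i _ => ?_
  rw [(O.measurableEmbedding_chart i).map_apply, preimage_univ, Measure.restrict_apply_univ]
  have : Bornology.IsBounded (O.chart i ⁻¹' intrinsicInterior ℝ (O.face i)) :=
    (O.isometry_chart i).antilipschitz.isBounded_preimage
      ((O.isCompact_face i).isBounded.subset (O.relint_subset_face i))
  exact this.measure_lt_top

lemma ae_surfaceMeasure_iff {p : E3 → Prop} : (∀ᵐ x ∂O.surfaceMeasure, p x) ↔
    ∀ i, ∀ᵐ w ∂(volume : Measure E2),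
      O.chart i w ∈ intrinsicInterior ℝ (O.face i) → p (O.chart i w) := by
  rw [surfaceMeasure, ae_finsetSum_measure_iff]
  simp only [Finset.mem_univ, forall_true_left]
  refine forall_congr' fun i => ?_
  rw [(O.measurableEmbedding_chart i).ae_map_iff,
    ae_restrict_iff' (O.continuous_chart i |>.measurable (O.measurableSet_relint i))]
  rfl

lemma ae_mem_regular : ∀ᵐ x ∂O.surfaceMeasure, x ∈ O.regular :=
  O.ae_surfaceMeasure_iff.2 fun i => ae_of_all _ fun _ hw => O.relint_subset_regular i hw

end TriangulatedObject

namespace TriangulatedObject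

open Filter Topology

variable (O : TriangulatedObject)

/-! ### Shadows -/

/-- The directions from `x` towards the points of a convex set form a convex cone. -/
lemma convex_directions {A : Set E3} (hA : Convex ℝ A) (x : E3) :
    Convex ℝ {v : E3 | ∃ t : ℝ, 0 < t ∧ x + t • v ∈ A} := by
  rintro v ⟨s, hs, hv⟩ v' ⟨s', hs', hv'⟩ a b ha hb hab
  have hpos : 0 < a / s + b / s' := by
    rcases ha.eq_or_lt with rfl | ha
    · have : b = 1 := by linarith
      subst this; positivity
    · positivity
  refine ⟨(a / s + b / s')⁻¹, inv_pos.2 hpos, ?_⟩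
  have h := hA hv hv' (a := (a / s + b / s')⁻¹ * (a / s)) (b := (a / s + b / s')⁻¹ * (b / s'))
    (by positivity) (by positivity) (by rw [← mul_add, inv_mul_cancel₀ hpos.ne'])
  convert h using 1
  have e1 : (a / s + b / s')⁻¹ * (a / s) + (a / s + b / s')⁻¹ * (b / s') = 1 := by
    rw [← mul_add, inv_mul_cancel₀ hpos.ne']
  have e2 : (a / s + b / s')⁻¹ * (a / s) * s = (a / s + b / s')⁻¹ * a := by
    rw [mul_assoc, div_mul_cancel₀ _ hs.ne']
  have e3 : (a / s + b / s')⁻¹ * (b / s') * s' = (a / s + b / s')⁻¹ * b := by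
    rw [mul_assoc, div_mul_cancel₀ _ hs'.ne']
  rw [smul_add, smul_add, smul_add, smul_smul, smul_smul, smul_smul, smul_smul, e2, e3]
  nth_rewrite 1 [show x = ((a / s + b / s')⁻¹ * (a / s) + (a / s + b / s')⁻¹ * (b / s')) • x by
    rw [e1, one_smul]]
  module

/-- The points from which the direction `u` meets a convex set form a convex set. -/
lemma convex_shadow {A : Set E3} (hA : Convex ℝ A) (u : E3) :
    Convex ℝ {x : E3 | ∃ t : ℝ, 0 < t ∧ x + t • u ∈ A} := by
  rintro x ⟨s, hs, hx⟩ x' ⟨s', hs', hx'⟩ a b ha hb hab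
  refine ⟨a * s + b * s', ?_, ?_⟩
  · rcases ha.eq_or_lt with rfl | ha
    · have : b = 1 := by linarith
      subst this; simpa using hs'
    · positivity
  · convert hA hx hx' ha hb hab using 1
    module

lemma norm_sphere (u : S2) : ‖(u : E3)‖ = 1 := mem_sphere_zero_iff_norm.1 u.2

/-- Shadows are open conditions on the direction: if all points near `x` of the plane of a face
see the convex set `A` in the direction `u`, then `x` sees `A` in all directions near `u`. -/
lemma eventually_exists_mem (i : Fin O.N) {A : Set E3} (hA : Convex ℝ A)
    (hAb : Bornology.IsBounded A) {u : S2} (hu : 0 < inner ℝ (O.normal i) (u : E3)) {w : E2}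
    (hw : w ∈ interior (O.chart i ⁻¹' {x | ∃ t : ℝ, 0 < t ∧ x + t • (u : E3) ∈ A})) :
    ∀ᶠ v : S2 in 𝓝 u, ∃ t : ℝ, 0 < t ∧ O.chart i w + t • (v : E3) ∈ A := by
  obtain ⟨ε, hε, hball⟩ := Metric.mem_nhds_iff.1 (mem_interior_iff_mem_nhds.1 hw)
  obtain ⟨R, hR⟩ := hAb.exists_norm_le
  have hself : w ∈ ball w ε := mem_ball_self hε
  obtain ⟨t₀, ht₀, hmem₀⟩ := hball hself
  set x := O.chart i w with hx
  set n := O.normal i with hn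
  have hR0 : 0 ≤ R := (norm_nonneg _).trans (hR _ hmem₀)
  -- an upper bound for the distance at which rays from near `x` meet `A`
  set T := R + ‖x‖ + ε with hT
  have hTpos : 0 < T := by positivity
  -- every direction near `u` is a positive multiple of `u + c` with a small `c` parallel to the
  -- face; as `x + T • c` sees `A` in the direction `u` at a distance `t ≤ T`, the cone of
  -- directions from `x` to `A` contains `u + (T / t) • c`, and by convexity also `u + c`
  set a : S2 → ℝ := fun v => inner ℝ n (v : E3) / inner ℝ n (u : E3) with ha
  set c : S2 → E3 := fun v => (a v)⁻¹ • ((v : E3) - a v • (u : E3)) with hc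
  have hau : a u = 1 := div_self hu.ne'
  have ha_cont : Continuous a := by fun_prop
  have ha_pos : ∀ᶠ v in 𝓝 u, 0 < a v :=
    ha_cont.continuousAt.eventually (lt_mem_nhds (by rw [hau]; exact one_pos))
  have hc_cont : ContinuousAt c u := by
    refine (ha_cont.continuousAt.inv₀ (by rw [hau]; exact one_ne_zero)).smul ?_
    fun_prop
  have hc_small : ∀ᶠ v in 𝓝 u, ‖T • c v‖ < ε := by
    have : ContinuousAt (fun v => ‖T • c v‖) u := (hc_cont.const_smul T).norm
    refine this.eventually (gt_mem_nhds ?_)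
    simp [hc, hau, hε]
  filter_upwards [ha_pos, hc_small] with v hav hcv
  have horth : inner ℝ n (T • c v) = 0 := by
    simp only [hc, inner_smul_right, inner_sub_right, ha]
    rw [div_mul_cancel₀ _ hu.ne']; simp
  obtain ⟨w', hw'⟩ := O.exists_chart_eq_add i w horth
  have hdist : w' ∈ ball w ε := by
    rw [mem_ball, ← (O.isometry_chart i).dist_eq, hw', dist_eq_norm, add_sub_cancel_left]
    exact hcv
  obtain ⟨t, ht, hmem⟩ := hball hdist
  rw [hw'] at hmem
  have htT : t ≤ T := by
    have h1 : ‖t • (u : E3)‖ = t := by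
      rw [norm_smul, norm_sphere, mul_one, Real.norm_of_nonneg ht.le]
    have h2 : t • (u : E3) = (x + T • c v + t • (u : E3)) - x - T • c v := by abel
    have h3 := norm_sub_le ((x + T • c v + t • (u : E3)) - x) (T • c v)
    have h4 := norm_sub_le (x + T • c v + t • (u : E3)) x
    rw [← h2, h1] at h3
    have h5 := hR _ hmem
    linarith
  have k1 : (u : E3) ∈ {v : E3 | ∃ t : ℝ, 0 < t ∧ x + t • v ∈ A} := ⟨t₀, ht₀, hmem₀⟩
  have k2 : (u : E3) + (T / t) • c v ∈ {v : E3 | ∃ t : ℝ, 0 < t ∧ x + t • v ∈ A} := by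
    refine ⟨t, ht, ?_⟩
    rw [smul_add, smul_smul, mul_div_cancel₀ _ ht.ne', ← add_assoc, add_right_comm]
    exact hmem
  obtain ⟨s, hs, hsm⟩ := convex_directions hA x k1 k2 (a := 1 - t / T) (b := t / T)
    (by rw [sub_nonneg, div_le_one hTpos]; exact htT) (by positivity) (by ring)
  refine ⟨s / a v, by positivity, ?_⟩
  convert hsm using 2
  have e1 : (1 - t / T) • (u : E3) + (t / T) • ((u : E3) + (T / t) • c v) = (u : E3) + c v := by
    rw [smul_add, smul_smul, div_mul_div_cancel₀ hTpos.ne', div_self ht.ne', one_smul]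
    module
  rw [e1, hc]
  simp only
  rw [smul_sub, smul_smul, inv_mul_cancel₀ hav.ne', one_smul, add_sub_cancel, smul_smul,
    div_eq_mul_inv]

/-- Being lit is an open condition on the direction, above the plane of the face. -/
lemma eventually_not_exists_mem {x n : E3} {r : ℝ} (hr : 0 < r)
    (hball : ∀ y ∈ ball x r, (y ∈ O.carrier ↔ inner ℝ n (y - x) ≤ 0)) {A : Set E3}
    (hA : IsCompact A) (hAO : A ⊆ O.carrier) {u : S2} (hu : 0 < inner ℝ n (u : E3))
    (hx : ¬ ∃ t : ℝ, 0 < t ∧ x + t • (u : E3) ∈ A) :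
    ∀ᶠ v : S2 in 𝓝 u, ¬ ∃ t : ℝ, 0 < t ∧ x + t • (v : E3) ∈ A := by
  obtain ⟨R, hR⟩ := hA.isBounded.exists_norm_le
  have hcl : IsClosed {v : S2 | ∃ t ∈ Icc r (R + ‖x‖), x + t • (v : E3) ∈ A} :=
    isClosed_exists_mem isCompact_Icc hA.isClosed
      (G := fun q : S2 × ℝ => x + q.2 • (q.1 : E3)) (by fun_prop)
  have hu' : u ∉ {v : S2 | ∃ t ∈ Icc r (R + ‖x‖), x + t • (v : E3) ∈ A} := by
    rintro ⟨t, ht, hm⟩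
    exact hx ⟨t, hr.trans_le ht.1, hm⟩
  have hpos : ∀ᶠ v : S2 in 𝓝 u, 0 < inner ℝ n (v : E3) :=
    (by fun_prop : Continuous fun v : S2 => inner ℝ n (v : E3)).continuousAt.eventually
      (lt_mem_nhds hu)
  filter_upwards [hcl.isOpen_compl.mem_nhds hu', hpos] with v hv hvn
  rintro ⟨t, ht, hm⟩
  have h1 : ‖t • (v : E3)‖ = t := by
      rw [norm_smul, norm_sphere, mul_one, Real.norm_of_nonneg ht.le]
  refine hv ⟨t, ⟨?_, ?_⟩, hm⟩
  · by_contra! hlt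
    have hb : x + t • (v : E3) ∈ ball x r := by
      rw [mem_ball, dist_eq_norm, add_sub_cancel_left, h1]; exact hlt
    have h2 := (hball _ hb).1 (hAO hm)
    rw [add_sub_cancel_left, inner_smul_right] at h2
    nlinarith [mul_pos ht hvn]
  · have h3 := norm_sub_le (x + t • (v : E3)) x
    rw [add_sub_cancel_left, h1] at h3
    linarith [hR _ hm]

/-- A ray that leaves the object transversally is blocked exactly when it meets a face. -/
lemma visDir_eq_ite (i : Fin O.N) {x : E3} (hx : x ∈ intrinsicInterior ℝ (O.face i)) {u : S2}
    (hu : 0 < inner ℝ (O.normal i) (u : E3)) [Decidable (∃ j, ∃ t : ℝ, 0 < t ∧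
      x + t • (u : E3) ∈ O.face j)] :
    O.visDir x u = if ∃ j, ∃ t : ℝ, 0 < t ∧ x + t • (u : E3) ∈ O.face j then 0 else 1 := by
  have hxO : x ∈ O.carrier :=
    O.frontier_subset_carrier (O.face_subset_frontier i (O.relint_subset_face i hx))
  rw [visDir_eq]
  split_ifs with h
  · obtain ⟨j, t, ht, hm⟩ := h
    refine indicator_of_notMem (fun hmem => hmem.2 ⟨t, ht, ?_⟩) _
    exact O.frontier_subset_carrier (O.face_subset_frontier j hm)
  · rw [indicator_of_mem]
    · rfl
    refine ⟨hxO, ?_⟩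
    rintro ⟨t, ht, hm⟩
    have ht : 0 < t := ht
    obtain ⟨r, hr, hball⟩ := O.outward_normal i x hx
    set s := min (r / 2) t with hs
    have hs0 : 0 < s := lt_min (half_pos hr) ht
    have hsn : x + s • (u : E3) ∉ O.carrier := by
      intro hmem
      have hb : x + s • (u : E3) ∈ ball x r := by
        rw [mem_ball, dist_eq_norm, add_sub_cancel_left, norm_smul, norm_sphere, mul_one,
          Real.norm_of_nonneg hs0.le]
        exact (min_le_left _ _).trans_lt (half_lt_self hr)
      have h2 := (hball _ hb).1 hmem
      rw [add_sub_cancel_left, inner_smul_right] at h2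
      nlinarith [mul_pos hs0 hu]
    have hconn : IsPreconnected ((fun t : ℝ => x + t • (u : E3)) '' Icc s t) :=
      isPreconnected_Icc.image _ (by fun_prop)
    -- between the points with parameters `s` and `t` the ray crosses the boundary
    have hst : s ≤ t := min_le_right _ _
    obtain ⟨_, ⟨t', ht', rfl⟩, hf⟩ : (((fun t : ℝ => x + t • (u : E3)) '' Icc s t) ∩
        frontier O.carrier).Nonempty := by
      by_contra hempty
      rw [not_nonempty_iff_eq_empty] at hempty
      have hint : ∀ y ∈ (fun t : ℝ => x + t • (u : E3)) '' Icc s t, y ∈ O.carrier →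
          y ∈ interior O.carrier := by
        intro y hy hyO
        by_contra hyi
        exact (notMem_empty y) (hempty ▸ ⟨hy, subset_closure hyO, hyi⟩)
      obtain ⟨y, -, hy1, hy2⟩ := hconn _ _ isOpen_interior O.isClosed_carrier.isOpen_compl
        (fun y hy => (em (y ∈ O.carrier)).imp (hint y hy) id)
        ⟨_, ⟨t, ⟨hst, le_rfl⟩, rfl⟩, hint _ ⟨t, ⟨hst, le_rfl⟩, rfl⟩ hm⟩
        ⟨_, ⟨s, ⟨le_rfl, hst⟩, rfl⟩, hsn⟩
      exact hy2 (interior_subset hy1)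
    rw [O.frontier_eq, mem_iUnion] at hf
    obtain ⟨j, hj⟩ := hf
    exact h ⟨j, t', hs0.trans_le ht'.1, hj⟩

/-- For every direction `u`, the direct reflectance at almost every point of the boundary is
continuous at `u`. -/
theorem ae_continuousAt_pointDirect (ρ : E3 → ℝ) (u : S2) :
    ∀ᵐ x ∂O.surfaceMeasure, ContinuousAt (fun v => O.pointDirect ρ v x) u := by
  classical
  refine O.ae_surfaceMeasure_iff.2 fun i => ?_
  have hnull : ∀ᵐ w ∂(volume : Measure E2), ∀ j, w ∉ frontier
      (O.chart i ⁻¹' {x | ∃ t : ℝ, 0 < t ∧ x + t • (u : E3) ∈ O.face j}) := by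
    refine ae_all_iff.2 fun j => ?_
    rw [ae_iff]
    simpa only [not_not] using! (O.convex_preimage_chart i
      (convex_shadow (O.convex_face j) (u : E3))).addHaar_frontier volume
  filter_upwards [hnull] with w hw hwi
  set x := O.chart i w with hx
  have hreg : x ∈ O.regular := O.relint_subset_regular i hwi
  have heq : (fun v => O.pointDirect ρ v x) =
      fun v : S2 => ρ x * max (inner ℝ (O.normal i) (v : E3)) 0 * O.visDir x v := by
    funext v
    rw [pointDirect, if_pos hreg, O.normalAt_eq i hwi]
  rw [heq]
  have hmax : Continuous fun v : S2 => ρ x * max (inner ℝ (O.normal i) (v : E3)) 0 := by fun_prop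
  rcases le_or_gt (inner ℝ (O.normal i) (u : E3)) 0 with hu | hu
  · have h0 : ρ x * max (inner ℝ (O.normal i) (u : E3)) 0 = 0 := by rw [max_eq_right hu, mul_zero]
    have h1 : Tendsto (fun v : S2 => |ρ x * max (inner ℝ (O.normal i) (v : E3)) 0|) (𝓝 u)
        (𝓝 0) := by
      have := (hmax.abs.tendsto u)
      rwa [h0, abs_zero] at this
    rw [ContinuousAt, h0, zero_mul]
    refine squeeze_zero_norm (fun v => ?_) h1
    rw [norm_mul, Real.norm_eq_abs, Real.norm_of_nonneg (O.visDir_nonneg x v)]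
    exact mul_le_of_le_one_right (abs_nonneg _) (O.visDir_le_one x v)
  · have hpos : ∀ᶠ v : S2 in 𝓝 u, 0 < inner ℝ (O.normal i) (v : E3) :=
      (by fun_prop : Continuous fun v : S2 => inner ℝ (O.normal i) (v : E3)).continuousAt.eventually
        (lt_mem_nhds hu)
    obtain ⟨r, hr, hball⟩ := O.outward_normal i x hwi
    have hconst : ∀ j, ∀ᶠ v : S2 in 𝓝 u, ((∃ t : ℝ, 0 < t ∧ x + t • (v : E3) ∈ O.face j) ↔
        ∃ t : ℝ, 0 < t ∧ x + t • (u : E3) ∈ O.face j) := by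
      intro j
      by_cases hj : ∃ t : ℝ, 0 < t ∧ x + t • (u : E3) ∈ O.face j
      · have hint : w ∈ interior
            (O.chart i ⁻¹' {x | ∃ t : ℝ, 0 < t ∧ x + t • (u : E3) ∈ O.face j}) := by
          by_contra hni
          exact hw j ⟨subset_closure hj, hni⟩
        filter_upwards [O.eventually_exists_mem i (O.convex_face j) (O.isCompact_face j).isBounded
          hu hint] with v hv
        exact ⟨fun _ => hj, fun _ => hv⟩
      · filter_upwards [O.eventually_not_exists_mem hr hball (O.isCompact_face j)
          ((O.face_subset_frontier j).trans O.frontier_subset_carrier) hu hj] with v hv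
        exact ⟨fun h => (hv h).elim, fun h => (hj h).elim⟩
    have hvis : (fun v => O.visDir x v) =ᶠ[𝓝 u] fun _ => O.visDir x u := by
      filter_upwards [hpos, eventually_all.2 hconst] with v hv hall
      rw [O.visDir_eq_ite i hwi hv, O.visDir_eq_ite i hwi hu]
      exact if_congr (exists_congr hall) rfl rfl
    exact hmax.continuousAt.mul (continuousAt_const.congr hvis.symm)

end TriangulatedObject

namespace TriangulatedObject

variable (O : TriangulatedObject) {ρ : E3 → ℝ}

/-! ### Direct illumination -/

lemma regular_subset_frontier : O.regular ⊆ frontier O.carrier :=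
  iUnion_subset fun i => (O.relint_subset_face i).trans (O.face_subset_frontier i)

lemma pointDirect_nonneg (hρ : O.IsAlbedo ρ) (u : S2) (x : E3) : 0 ≤ O.pointDirect ρ u x := by
  rw [pointDirect]
  split_ifs with hx
  · have h1 := (hρ.pos x (O.regular_subset_frontier hx)).le
    have h2 := O.visDir_nonneg x u
    positivity
  · exact le_rfl

lemma pointDirect_le_one (hρ : O.IsAlbedo ρ) (u : S2) (x : E3) : O.pointDirect ρ u x ≤ 1 := by
  rw [pointDirect]
  split_ifs with hx
  · have h1 := (hρ.pos x (O.regular_subset_frontier hx)).le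
    have h1' := hρ.le_one x (O.regular_subset_frontier hx)
    have h2 : inner ℝ (O.normalAt x) (u : E3) ≤ 1 := by
      refine (real_inner_le_norm _ _).trans ?_
      rw [norm_sphere, mul_one]
      exact O.norm_normalAt_le x
    exact mul_le_one₀ (mul_le_one₀ h1' (le_max_right _ _) (max_le h2 zero_le_one))
      (O.visDir_nonneg x u) (O.visDir_le_one x u)
  · exact zero_le_one

lemma norm_pointDirect_le (hρ : O.IsAlbedo ρ) (u : S2) (x : E3) : ‖O.pointDirect ρ u x‖ ≤ 1 := by
  rw [Real.norm_of_nonneg (O.pointDirect_nonneg hρ u x)]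
  exact O.pointDirect_le_one hρ u x

/-- The direct reflectance as the albedo times a Borel function of position and direction. -/
lemma pointDirect_eq_mul (u : S2) (x : E3) : O.pointDirect ρ u x =
    ρ x * O.regular.indicator
      (fun x => max (inner ℝ (O.normalAt x) (u : E3)) 0 * O.visDir x u) x := by
  classical
  rw [pointDirect, indicator_apply]
  split_ifs <;> ring

lemma measurable_geometric_factor : Measurable fun p : E3 × S2 => O.regular.indicator
    (fun x => max (inner ℝ (O.normalAt x) (p.2 : E3)) 0 * O.visDir x p.2) p.1 := by
  have h := O.measurable_normalAt
  have h1 : Measurable fun p : E3 × S2 =>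
      max (inner ℝ (O.normalAt p.1) (p.2 : E3)) 0 * O.visDir p.1 p.2 := by
    refine Measurable.mul (Measurable.max ?_ measurable_const) O.measurable_visDir
    exact (h.comp measurable_fst).inner (measurable_subtype_coe.comp measurable_snd)
  exact h1.indicator (measurable_fst O.measurableSet_regular)

lemma measurable_pointDirect_direction (x : E3) : Measurable fun u => O.pointDirect ρ u x := by
  simp_rw [pointDirect_eq_mul]
  exact (O.measurable_geometric_factor.comp measurable_prodMk_left).const_mul _

lemma aemeasurable_pointDirect_prod (hρ : O.IsAlbedo ρ) {ν : Measure S2} [SFinite ν] :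
    AEMeasurable (fun p : E3 × S2 => O.pointDirect ρ p.2 p.1) (O.surfaceMeasure.prod ν) := by
  simp_rw [pointDirect_eq_mul]
  exact hρ.aemeasurable.comp_fst.mul O.measurable_geometric_factor.aemeasurable

lemma aemeasurable_pointDirect (hρ : O.IsAlbedo ρ) (u : S2) :
    AEMeasurable (O.pointDirect ρ u) O.surfaceMeasure := by
  have : O.pointDirect ρ u = fun x => ρ x * O.regular.indicator
      (fun x => max (inner ℝ (O.normalAt x) (u : E3)) 0 * O.visDir x u) x :=
    funext fun x => O.pointDirect_eq_mul u x
  rw [this]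
  exact hρ.aemeasurable.mul
    (O.measurable_geometric_factor.comp measurable_prodMk_right).aemeasurable

theorem pointDirect_mem_L2 (hρ : O.IsAlbedo ρ) (u : S2) : O.pointDirect ρ u ∈ O.L2 :=
  MemLp.of_bound (O.aemeasurable_pointDirect hρ u).aestronglyMeasurable 1
    (ae_of_all _ fun x => O.norm_pointDirect_le hρ u x)

theorem integrable_pointDirect_mul (hρ : O.IsAlbedo ρ) {ν : Measure S2} {f : S2 → ℝ}
    (hf : Integrable f ν) (x : E3) : Integrable (fun u => O.pointDirect ρ u x * f u) ν :=
  hf.bdd_mul (O.measurable_pointDirect_direction x).aestronglyMeasurable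
    (ae_of_all _ fun u => O.norm_pointDirect_le hρ u x)

instance isFiniteMeasure_sphereMeasure : IsFiniteMeasure sphereMeasure := by
  unfold sphereMeasure; infer_instance

theorem direct_mem_L2 (hρ : O.IsAlbedo ρ) {f : S2 → ℝ} (hf : Integrable f sphereMeasure) :
    O.direct ρ f ∈ O.L2 := by
  refine MemLp.of_bound (C := ∫ u, ‖f u‖ ∂sphereMeasure) ?_ (ae_of_all _ fun x => ?_)
  · exact AEStronglyMeasurable.integral_prod_right'
      (f := fun p : E3 × S2 => O.pointDirect ρ p.2 p.1 * f p.2)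
      ((O.aemeasurable_pointDirect_prod hρ).aestronglyMeasurable.mul
        hf.aestronglyMeasurable.comp_snd)
  · refine norm_integral_le_of_norm_le hf.norm (ae_of_all _ fun u => ?_)
    rw [norm_mul]
    exact mul_le_of_le_one_left (norm_nonneg _) (O.norm_pointDirect_le hρ u x)

/-! ### The interreflection operator -/

/-- Near a relative interior point of a face the boundary lies in the plane of the face. -/
lemma inner_eq_zero_of_mem_frontier {A : Set E3} (hA : IsClosed A) {x n y : E3} {r : ℝ}
    (hball : ∀ y ∈ ball x r, (y ∈ A ↔ inner ℝ n (y - x) ≤ 0))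
    (hy : y ∈ frontier A) (hyr : y ∈ ball x r) : inner ℝ n (y - x) = 0 := by
  refine le_antisymm ((hball y hyr).1 (hA.frontier_subset hy)) ?_
  by_contra! hlt
  refine hy.2 (mem_interior_iff_mem_nhds.2 ?_)
  have hcont : Continuous fun z : E3 => inner ℝ n (z - x) := by fun_prop
  filter_upwards [isOpen_ball.mem_nhds hyr, hcont.continuousAt.eventually (gt_mem_nhds hlt)]
    with z hz hzn
  exact (hball z hz).2 (le_of_lt hzn)

/-- The kernel is bounded in its second variable, since faces do not illuminate themselves. -/
lemma exists_kernel_le (hρ : O.IsAlbedo ρ) {x : E3} (hx : x ∈ O.regular) :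
    ∃ C, ∀ x', ‖O.kernel ρ x x'‖ ≤ C := by
  obtain ⟨i, hi⟩ := mem_iUnion.1 hx
  obtain ⟨r, hr, hball⟩ := O.outward_normal i x hi
  refine ⟨1 / r ^ 2, fun x' => ?_⟩
  have hC : 0 ≤ 1 / r ^ 2 := by positivity
  have hpi := Real.pi_gt_three
  have hρ0 := (hρ.pos x (O.regular_subset_frontier hx)).le
  have hρ1 : ρ x / Real.pi ≤ 1 := by
    rw [div_le_one (by linarith)]
    linarith [hρ.le_one x (O.regular_subset_frontier hx)]
  rw [kernel, norm_mul, norm_mul, Real.norm_of_nonneg (O.visPt_nonneg x x'),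
    Real.norm_of_nonneg (by positivity : 0 ≤ ρ x / Real.pi), norm_div, norm_mul,
    norm_pow, norm_norm]
  refine (mul_le_of_le_one_right (by positivity) (O.visPt_le_one x x')).trans ?_
  refine (mul_le_of_le_one_left (by positivity) hρ1).trans ?_
  by_cases hx' : x' ∈ O.regular
  · by_cases hd : x' ∈ ball x r
    · rw [O.normalAt_eq i hi, inner_eq_zero_of_mem_frontier O.isClosed_carrier hball
        (O.regular_subset_frontier hx') hd]
      simpa using hC
    · rw [mem_ball, not_lt, dist_comm, dist_eq_norm] at hd
      have hpos : 0 < ‖x - x'‖ := lt_of_lt_of_le hr hd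
      have h1 : ‖inner ℝ (O.normalAt x') (x - x')‖ ≤ ‖x - x'‖ :=
        (norm_inner_le_norm _ _).trans
          (mul_le_of_le_one_left (norm_nonneg _) (O.norm_normalAt_le x'))
      have h2 : ‖inner ℝ (O.normalAt x) (x' - x)‖ ≤ ‖x - x'‖ := by
        rw [norm_sub_rev x x']
        exact (norm_inner_le_norm _ _).trans
          (mul_le_of_le_one_left (norm_nonneg _) (O.norm_normalAt_le x))
      calc ‖inner ℝ (O.normalAt x') (x - x')‖ * ‖inner ℝ (O.normalAt x) (x' - x)‖ / ‖x - x'‖ ^ 4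
          ≤ ‖x - x'‖ * ‖x - x'‖ / ‖x - x'‖ ^ 4 := by gcongr
        _ = 1 / ‖x - x'‖ ^ 2 := by field_simp
        _ ≤ 1 / r ^ 2 := by gcongr
  · rw [O.normalAt_of_notMem hx']
    simpa using hC

/-- The geometric part of the interreflection kernel. -/
def geometricKernel (p : E3 × E3) : ℝ :=
  inner ℝ (O.normalAt p.2) (p.1 - p.2) * inner ℝ (O.normalAt p.1) (p.2 - p.1) /
    ‖p.1 - p.2‖ ^ 4 * O.visPt p.1 p.2

lemma kernel_eq_mul (x x' : E3) :
    O.kernel ρ x x' = ρ x / Real.pi * O.geometricKernel (x, x') := by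
  rw [kernel, geometricKernel, mul_assoc]

lemma measurable_geometricKernel : Measurable O.geometricKernel := by
  have h := O.measurable_normalAt
  refine Measurable.mul (Measurable.div (Measurable.mul ?_ ?_) (by fun_prop)) O.measurable_visPt
  · exact (h.comp measurable_snd).inner (by fun_prop)
  · exact (h.comp measurable_fst).inner (by fun_prop)

lemma measurable_kernel_right (x : E3) : Measurable (O.kernel ρ x) := by
  have : O.kernel ρ x = fun x' => ρ x / Real.pi * O.geometricKernel (x, x') :=
    funext fun x' => O.kernel_eq_mul x x'
  rw [this]
  exact (O.measurable_geometricKernel.comp measurable_prodMk_left).const_mul _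

lemma integrable_of_memLp {g : E3 → ℝ} (hg : MemLp g 2 O.surfaceMeasure) :
    Integrable g O.surfaceMeasure :=
  hg.integrable one_le_two

lemma integrable_kernel_mul (hρ : O.IsAlbedo ρ) {g : E3 → ℝ} (hg : MemLp g 2 O.surfaceMeasure)
    {x : E3}
    (hx : x ∈ O.regular) : Integrable (fun x' => O.kernel ρ x x' * g x') O.surfaceMeasure := by
  obtain ⟨C, hC⟩ := O.exists_kernel_le hρ hx
  exact (O.integrable_of_memLp hg).bdd_mul (O.measurable_kernel_right x).aestronglyMeasurable
    (ae_of_all _ hC)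

lemma interreflection_congr {g g' : E3 → ℝ} (h : g =ᵐ[O.surfaceMeasure] g') :
    O.interreflection ρ g = O.interreflection ρ g' := by
  classical
  funext x
  rw [interreflection, interreflection]
  refine if_congr Iff.rfl (integral_congr_ae ?_) rfl
  filter_upwards [h] with x' hx'
  rw [hx']

lemma interreflection_add (hρ : O.IsAlbedo ρ) {g g' : E3 → ℝ}
    (hg : MemLp g 2 O.surfaceMeasure) (hg' : MemLp g' 2 O.surfaceMeasure) :
    O.interreflection ρ (g + g') = O.interreflection ρ g + O.interreflection ρ g' := by
  funext x
  simp only [interreflection, Pi.add_apply]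
  split_ifs with hx
  · simp only [mul_add]
    exact integral_add (O.integrable_kernel_mul hρ hg hx) (O.integrable_kernel_mul hρ hg' hx)
  · rw [add_zero]

lemma interreflection_smul (c : ℝ) (g : E3 → ℝ) :
    O.interreflection ρ (c • g) = c • O.interreflection ρ g := by
  funext x
  simp only [interreflection, Pi.smul_apply, smul_eq_mul]
  split_ifs with hx
  · rw [← integral_const_mul]
    exact integral_congr_ae (ae_of_all _ fun x' => by ring)
  · rw [mul_zero]

lemma aestronglyMeasurable_interreflection (hρ : O.IsAlbedo ρ) {g : E3 → ℝ}
    (hg : MemLp g 2 O.surfaceMeasure) :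
    AEStronglyMeasurable (O.interreflection ρ g) O.surfaceMeasure := by
  have h1 : AEStronglyMeasurable (fun x => ∫ x', O.kernel ρ x x' * g x' ∂O.surfaceMeasure)
      O.surfaceMeasure := by
    refine AEStronglyMeasurable.integral_prod_right'
      (f := fun p : E3 × E3 => O.kernel ρ p.1 p.2 * g p.2) (AEStronglyMeasurable.mul ?_ ?_)
    · simp_rw [kernel_eq_mul]
      exact ((hρ.aemeasurable.div_const _).comp_fst.mul
        O.measurable_geometricKernel.aemeasurable).aestronglyMeasurable
    · exact hg.aestronglyMeasurable.comp_snd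
  refine h1.congr ?_
  filter_upwards [O.ae_mem_regular] with x hx
  rw [interreflection, if_pos hx]

/-- The operator norm bounds the interreflection operator. -/
lemma eLpNorm_interreflection_le {g : E3 → ℝ} (hg : MemLp g 2 O.surfaceMeasure) :
    eLpNorm (O.interreflection ρ g) 2 O.surfaceMeasure ≤
      O.interreflectionNorm ρ * eLpNorm g 2 O.surfaceMeasure := by
  by_cases h0 : eLpNorm g 2 O.surfaceMeasure = 0
  · have hz : g =ᵐ[O.surfaceMeasure] 0 :=
      (eLpNorm_eq_zero_iff hg.aestronglyMeasurable two_ne_zero).1 h0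
    have hT0 : O.interreflection ρ (0 : E3 → ℝ) = 0 := by
      simpa using O.interreflection_smul (ρ := ρ) 0 0
    rw [O.interreflection_congr hz, hT0]
    simp
  · set N := (eLpNorm g 2 O.surfaceMeasure).toReal with hN
    have hNpos : 0 < N := ENNReal.toReal_pos h0 hg.eLpNorm_ne_top
    have hNe : ENNReal.ofReal N = eLpNorm g 2 O.surfaceMeasure :=
      ENNReal.ofReal_toReal hg.eLpNorm_ne_top
    have hmem : N⁻¹ • g ∈ {g : E3 → ℝ | g ∈ O.L2 ∧ eLpNorm g 2 O.surfaceMeasure ≤ 1} := by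
      refine ⟨hg.const_smul _, ?_⟩
      rw [eLpNorm_const_smul, Real.enorm_eq_ofReal (by positivity), ← hNe,
        ← ENNReal.ofReal_mul (by positivity), inv_mul_cancel₀ hNpos.ne', ENNReal.ofReal_one]
    have h1 : eLpNorm (O.interreflection ρ (N⁻¹ • g)) 2 O.surfaceMeasure ≤
        O.interreflectionNorm ρ :=
      le_iSup₂ (f := fun g (_ : g ∈ {g : E3 → ℝ | g ∈ O.L2 ∧ eLpNorm g 2 O.surfaceMeasure ≤ 1}) =>
        eLpNorm (O.interreflection ρ g) 2 O.surfaceMeasure) _ hmem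
    have h2 : O.interreflection ρ g = N • O.interreflection ρ (N⁻¹ • g) := by
      rw [← interreflection_smul, smul_smul, mul_inv_cancel₀ hNpos.ne', one_smul]
    rw [h2, eLpNorm_const_smul, Real.enorm_eq_ofReal hNpos.le, hNe, mul_comm]
    gcongr

lemma memLp_interreflection (hρ : O.IsAlbedo ρ) (hT : O.interreflectionNorm ρ < 1) {g : E3 → ℝ}
    (hg : MemLp g 2 O.surfaceMeasure) : MemLp (O.interreflection ρ g) 2 O.surfaceMeasure :=
  ⟨O.aestronglyMeasurable_interreflection hρ hg, (O.eLpNorm_interreflection_le hg).trans_lt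
    (ENNReal.mul_lt_top (hT.trans ENNReal.one_lt_top) hg.eLpNorm_lt_top)⟩

/-- The interreflection operator on the Hilbert space of classes of functions. -/
def interreflectionLp (hρ : O.IsAlbedo ρ) (hT : O.interreflectionNorm ρ < 1) :
    Lp ℝ 2 O.surfaceMeasure →L[ℝ] Lp ℝ 2 O.surfaceMeasure :=
  LinearMap.mkContinuous
    { toFun := fun g => MemLp.toLp _ (O.memLp_interreflection hρ hT (Lp.memLp g))
      map_add' := fun g g' => by
        rw [← MemLp.toLp_add]
        refine MemLp.toLp_congr _ _ (Filter.EventuallyEq.of_eq ?_)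
        rw [O.interreflection_congr (Lp.coeFn_add g g'),
          O.interreflection_add hρ (Lp.memLp g) (Lp.memLp g')]
      map_smul' := fun c g => by
        rw [RingHom.id_apply, ← MemLp.toLp_const_smul]
        refine MemLp.toLp_congr _ _ (Filter.EventuallyEq.of_eq ?_)
        rw [O.interreflection_congr (Lp.coeFn_smul c g), O.interreflection_smul] }
    (O.interreflectionNorm ρ).toReal fun g => by
      rw [LinearMap.coe_mk, AddHom.coe_mk, Lp.norm_toLp, Lp.norm_def, ← ENNReal.toReal_mul]
      exact ENNReal.toReal_mono (ENNReal.mul_ne_top (hT.trans ENNReal.one_lt_top).ne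
        (Lp.eLpNorm_ne_top g)) (O.eLpNorm_interreflection_le (Lp.memLp g))

lemma interreflectionLp_toLp (hρ : O.IsAlbedo ρ) (hT : O.interreflectionNorm ρ < 1) {g : E3 → ℝ}
    (hg : MemLp g 2 O.surfaceMeasure) :
    O.interreflectionLp hρ hT (MemLp.toLp g hg) =
      MemLp.toLp _ (O.memLp_interreflection hρ hT hg) :=
  MemLp.toLp_congr (O.memLp_interreflection hρ hT (Lp.memLp _)) _
    (Filter.EventuallyEq.of_eq (O.interreflection_congr (MemLp.coeFn_toLp hg)))

lemma norm_interreflectionLp_lt_one (hρ : O.IsAlbedo ρ) (hT : O.interreflectionNorm ρ < 1) :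
    ‖O.interreflectionLp hρ hT‖ < 1 := by
  refine (LinearMap.mkContinuous_norm_le _ ENNReal.toReal_nonneg _).trans_lt ?_
  rw [← ENNReal.toReal_one]
  exact (ENNReal.toReal_lt_toReal (hT.trans ENNReal.one_lt_top).ne ENNReal.one_ne_top).2 hT

/-- The inverse of `I - T` on the Hilbert space, given by the Neumann series. -/
def resolventLp (hρ : O.IsAlbedo ρ) (hT : O.interreflectionNorm ρ < 1) :
    Lp ℝ 2 O.surfaceMeasure →L[ℝ] Lp ℝ 2 O.surfaceMeasure :=
  ((Units.oneSub _ (O.norm_interreflectionLp_lt_one hρ hT))⁻¹ : Units _).val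

lemma resolventLp_sub (hρ : O.IsAlbedo ρ) (hT : O.interreflectionNorm ρ < 1)
    (g : Lp ℝ 2 O.surfaceMeasure) :
    O.resolventLp hρ hT (g - O.interreflectionLp hρ hT g) = g := by
  have h := Units.inv_mul (Units.oneSub _ (O.norm_interreflectionLp_lt_one hρ hT))
  exact congrArg (fun A : Lp ℝ 2 O.surfaceMeasure →L[ℝ] Lp ℝ 2 O.surfaceMeasure => A g) h

lemma sub_resolventLp (hρ : O.IsAlbedo ρ) (hT : O.interreflectionNorm ρ < 1)
    (g : Lp ℝ 2 O.surfaceMeasure) :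
    O.resolventLp hρ hT g - O.interreflectionLp hρ hT (O.resolventLp hρ hT g) = g := by
  have h := Units.mul_inv (Units.oneSub _ (O.norm_interreflectionLp_lt_one hρ hT))
  exact congrArg (fun A : Lp ℝ 2 O.surfaceMeasure →L[ℝ] Lp ℝ 2 O.surfaceMeasure => A g) h

lemma memLp_idSubInterreflection (hρ : O.IsAlbedo ρ) (hT : O.interreflectionNorm ρ < 1)
    {g : E3 → ℝ} (hg : MemLp g 2 O.surfaceMeasure) :
    MemLp (O.idSubInterreflection ρ g) 2 O.surfaceMeasure :=
  hg.sub (O.memLp_interreflection hρ hT hg)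

lemma resolventLp_idSub (hρ : O.IsAlbedo ρ) (hT : O.interreflectionNorm ρ < 1) {g : E3 → ℝ}
    (hg : MemLp g 2 O.surfaceMeasure) :
    O.resolventLp hρ hT (MemLp.toLp _ (O.memLp_idSubInterreflection hρ hT hg)) =
      MemLp.toLp g hg := by
  have h : MemLp.toLp _ (O.memLp_idSubInterreflection hρ hT hg) =
      MemLp.toLp g hg - O.interreflectionLp hρ hT (MemLp.toLp g hg) := by
    rw [interreflectionLp_toLp, ← MemLp.toLp_sub]
    rfl
  rw [h, resolventLp_sub]

/-- `I - T` is a bijection on functions, not just on classes: a solution in the class sense is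
corrected on a null set, which does not change its image under `T`. -/
theorem bijOn_idSubInterreflection (hρ : O.IsAlbedo ρ) (hT : O.interreflectionNorm ρ < 1) :
    BijOn (O.idSubInterreflection ρ) O.L2 O.L2 := by
  refine ⟨fun g hg => O.memLp_idSubInterreflection hρ hT hg, fun g hg g' hg' h => ?_,
    fun h hh => ?_⟩
  · have hg : MemLp g 2 O.surfaceMeasure := hg
    have hg' : MemLp g' 2 O.surfaceMeasure := hg'
    have h1 : MemLp.toLp g hg = MemLp.toLp g' hg' := by
      rw [← O.resolventLp_idSub hρ hT hg, ← O.resolventLp_idSub hρ hT hg']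
      congr 2
    have h2 := O.interreflection_congr (ρ := ρ) ((MemLp.toLp_eq_toLp_iff _ _).1 h1)
    funext x
    have h3 := congrFun h x
    rw [idSubInterreflection, idSubInterreflection, h2] at h3
    exact sub_left_inj.1 h3
  · have hh : MemLp h 2 O.surfaceMeasure := hh
    set G := O.resolventLp hρ hT (MemLp.toLp h hh) with hG
    have hTG := O.memLp_interreflection hρ hT (Lp.memLp G)
    have hae : h + O.interreflection ρ G =ᵐ[O.surfaceMeasure] G := by
      have h1 : MemLp.toLp _ (hh.add hTG) = G := by
        rw [MemLp.toLp_add hh hTG]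
        refine (sub_eq_iff_eq_add.1 ?_).symm
        exact O.sub_resolventLp hρ hT (MemLp.toLp h hh)
      have h2 := MemLp.coeFn_toLp (hh.add hTG)
      rw [h1] at h2
      exact h2.symm
    refine ⟨_, hh.add hTG, ?_⟩
    funext x
    rw [idSubInterreflection, O.interreflection_congr hae]
    simp

lemma memLp_resolvent (hρ : O.IsAlbedo ρ) (hT : O.interreflectionNorm ρ < 1) {g : E3 → ℝ}
    (hg : MemLp g 2 O.surfaceMeasure) : MemLp (O.resolvent ρ g) 2 O.surfaceMeasure :=
  (O.bijOn_idSubInterreflection hρ hT).surjOn.mapsTo_invFunOn hg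

lemma toLp_resolvent (hρ : O.IsAlbedo ρ) (hT : O.interreflectionNorm ρ < 1) {g : E3 → ℝ}
    (hg : MemLp g 2 O.surfaceMeasure) :
    MemLp.toLp _ (O.memLp_resolvent hρ hT hg) = O.resolventLp hρ hT (MemLp.toLp g hg) := by
  rw [← O.resolventLp_idSub hρ hT (O.memLp_resolvent hρ hT hg)]
  congr 1
  refine MemLp.toLp_congr _ _ (Filter.EventuallyEq.of_eq ?_)
  exact (O.bijOn_idSubInterreflection hρ hT).surjOn.rightInvOn_invFunOn hg

end TriangulatedObject

namespace Camera

variable {m : ℕ} (C : Camera m) (O : TriangulatedObject)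

/-! ### The perspective projection -/

/-- Two visible points on the same line of sight coincide. -/
lemma injOn_proj (hfront : ∀ x ∈ O.carrier, 0 < x 2) : InjOn C.proj O.visible := by
  have key : ∀ x ∈ O.visible, ∀ y ∈ O.visible, C.proj x = C.proj y → x 2 ≤ y 2 → x = y := by
    intro x hx y hy h hle
    have hxO := O.frontier_subset_carrier hx.1
    have hx2 := hfront x hxO
    have hy2 := hfront y (O.frontier_subset_carrier hy.1)
    have hf := C.focal_pos.ne'
    have e0 : x 0 = x 2 / y 2 * y 0 := by
      have h0 : -C.focal * x 0 / x 2 = -C.focal * y 0 / y 2 := congrArg (fun z : E2 => z 0) h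
      field_simp at h0 ⊢
      linarith
    have e1 : x 1 = x 2 / y 2 * y 1 := by
      have h0 : -C.focal * x 1 / x 2 = -C.focal * y 1 / y 2 := congrArg (fun z : E2 => z 1) h
      field_simp at h0 ⊢
      linarith
    have hxy : x = (x 2 / y 2) • y := by
      ext i
      fin_cases i
      · exact e0
      · exact e1
      · change x 2 = x 2 / y 2 * y 2
        rw [div_mul_cancel₀ _ hy2.ne']
    have hmem : x ∈ segment ℝ y 0 ∩ O.carrier := by
      refine ⟨⟨x 2 / y 2, 1 - x 2 / y 2, by positivity, ?_, by ring, ?_⟩, hxO⟩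
      · rw [sub_nonneg, div_le_one hy2]; exact hle
      · rw [smul_zero, add_zero]; exact hxy.symm
    rw [hy.2] at hmem
    exact hmem
  intro x hx y hy h
  rcases le_total (x 2) (y 2) with hle | hle
  · exact key x hx y hy h hle
  · exact (key y hy x hx h.symm hle).symm

/-- The projection of a face, in the coordinates of the chart. -/
def faceProj (k : Fin O.N) (w : E2) : E2 := C.proj (O.chart k w)

/-- The part of the parameter plane of a face in front of the camera. -/
def frontDomain (k : Fin O.N) : Set E2 := {w | 0 < O.chart k w 2}

lemma contDiff_chart (k : Fin O.N) : ContDiff ℝ 1 (O.chart k) := by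
  have : O.chart k = fun w => O.vertex k 0 +
      ((vectorSpan ℝ (range (O.vertex k))).subtypeL.comp
        ((O.faceBasis k).repr.symm.toContinuousLinearEquiv : E2 →L[ℝ] _)) w := rfl
  rw [this]
  exact contDiff_const.add (ContinuousLinearMap.contDiff _)

lemma isOpen_frontDomain (k : Fin O.N) : IsOpen (frontDomain O k) := by
  have := O.continuous_chart k
  exact isOpen_lt continuous_const (by fun_prop)

lemma contDiffOn_faceProj (k : Fin O.N) : ContDiffOn ℝ 1 (C.faceProj O k) (frontDomain O k) := by
  have hc (j : Fin 3) : ContDiff ℝ 1 fun w => O.chart k w j :=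
    (EuclideanSpace.proj j : E3 →L[ℝ] ℝ).contDiff.comp (contDiff_chart O k)
  rw [contDiffOn_euclidean]
  intro j
  fin_cases j
  · exact (contDiffOn_const.mul (hc 0).contDiffOn).div (hc 2).contDiffOn fun w hw => ne_of_gt hw
  · exact (contDiffOn_const.mul (hc 1).contDiffOn).div (hc 2).contDiffOn fun w hw => ne_of_gt hw

variable {O} in
lemma preimage_face_subset_frontDomain (hfront : ∀ x ∈ O.carrier, 0 < x 2) (k : Fin O.N) :
    O.chart k ⁻¹' O.face k ⊆ frontDomain O k :=
  fun _ hw => hfront _ (O.frontier_subset_carrier (O.face_subset_frontier k hw))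

lemma isCompact_preimage_face (k : Fin O.N) : IsCompact (O.chart k ⁻¹' O.face k) :=
  (O.isometry_chart k).isClosedEmbedding.isCompact_preimage (O.isCompact_face k)

lemma continuousOn_det_faceProj (k : Fin O.N) :
    ContinuousOn (fun w => (fderiv ℝ (C.faceProj O k) w).det) (frontDomain O k) :=
  ContinuousLinearMap.continuous_det.comp_continuousOn
    ((C.contDiffOn_faceProj O k).continuousOn_fderiv_of_isOpen (isOpen_frontDomain O k) le_rfl)

/-- The parameters of the visible relative interior points of a face. -/
def litParameters (k : Fin O.N) : Set E2 :=
  O.chart k ⁻¹' (O.visible ∩ intrinsicInterior ℝ (O.face k))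

lemma litParameters_subset (k : Fin O.N) : litParameters O k ⊆ O.chart k ⁻¹' O.face k :=
  fun _ hw => O.relint_subset_face k hw.2

lemma litParameters_subset_relint (k : Fin O.N) :
    litParameters O k ⊆ O.chart k ⁻¹' intrinsicInterior ℝ (O.face k) :=
  fun _ hw => hw.2

variable {O} in
lemma measurableSet_litParameters (hfront : ∀ x ∈ O.carrier, 0 < x 2) (k : Fin O.N) :
    MeasurableSet (litParameters O k) :=
  (O.continuous_chart k).measurable
    ((O.measurableSet_visible hfront).inter (O.measurableSet_relint k))

variable {O} in
lemma injOn_faceProj (hfront : ∀ x ∈ O.carrier, 0 < x 2) (k : Fin O.N) :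
    InjOn (C.faceProj O k) (litParameters O k) := fun _ hw _ hw' h =>
  (O.isometry_chart k).injective (C.injOn_proj O hfront hw.1 hw'.1 h)

variable {O} in
lemma hasFDerivWithinAt_faceProj (hfront : ∀ x ∈ O.carrier, 0 < x 2) (k : Fin O.N) :
    ∀ w ∈ litParameters O k, HasFDerivWithinAt (C.faceProj O k) (fderiv ℝ (C.faceProj O k) w)
      (litParameters O k) w := fun _ hw =>
  (((C.contDiffOn_faceProj O k).differentiableOn one_ne_zero).differentiableAt
    ((isOpen_frontDomain O k).mem_nhds (preimage_face_subset_frontDomain hfront k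
      (litParameters_subset O k hw)))).hasFDerivAt.hasFDerivWithinAt

variable {O} in
lemma projInv_faceProj (hfront : ∀ x ∈ O.carrier, 0 < x 2) (k : Fin O.N) {w : E2}
    (hw : w ∈ litParameters O k) : C.projInv O (C.faceProj O k w) = O.chart k w :=
  (C.injOn_proj O hfront).leftInvOn_invFunOn hw.1

variable {O} in
/-- Up to a null set, the image of the visible part of the object is the union of the images of
the visible relative interiors of the faces. -/
lemma exists_null_cover (hfront : ∀ x ∈ O.carrier, 0 < x 2) :
    ∃ Z : Set E2, volume Z = 0 ∧
      C.proj '' O.visible ⊆ (⋃ k, C.faceProj O k '' litParameters O k) ∪ Z := by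
  refine ⟨⋃ k, C.faceProj O k '' (O.chart k ⁻¹' (O.face k \ intrinsicInterior ℝ (O.face k))),
    measure_iUnion_null fun k => ?_, ?_⟩
  · refine addHaar_image_eq_zero_of_differentiableOn_of_addHaar_eq_zero volume ?_
      (O.volume_preimage_face_diff_relint k)
    exact ((C.contDiffOn_faceProj O k).differentiableOn one_ne_zero).mono
      fun _ hw => preimage_face_subset_frontDomain hfront k hw.1
  · rintro _ ⟨x, hx, rfl⟩
    have hf := hx.1
    rw [O.frontier_eq, mem_iUnion] at hf
    obtain ⟨k, hk⟩ := hf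
    obtain ⟨w, rfl⟩ := O.exists_chart_eq k hk
    by_cases hr : O.chart k w ∈ intrinsicInterior ℝ (O.face k)
    · exact Or.inl (mem_iUnion.2 ⟨k, w, ⟨hx, hr⟩, rfl⟩)
    · exact Or.inr (mem_iUnion.2 ⟨k, w, ⟨hk, hr⟩, rfl⟩)

/-! ### The sensor -/

lemma measurable_cosAngle : Measurable C.cosAngle := by
  have h : Measurable C.imagePoint := by
    refine (PiLp.continuous_toLp 2 _).measurable.comp (measurable_pi_lambda _ fun i => ?_)
    fin_cases i <;> simp <;> fun_prop
  unfold cosAngle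
  fun_prop

lemma norm_cosAngle_le (z : E2) : ‖C.cosAngle z‖ ≤ 1 := by
  rw [cosAngle]
  refine (norm_inner_le_norm _ _).trans ?_
  rw [PiLp.norm_single, norm_one, mul_one, norm_smul, norm_inv, norm_norm]
  exact inv_mul_le_one

lemma norm_cosAngle_pow_le (z : E2) : ‖C.cosAngle z ^ 4‖ ≤ 1 := by
  rw [norm_pow]; exact pow_le_one₀ (norm_nonneg _) (C.norm_cosAngle_le z)

variable {O}

lemma integrableOn_chart {g : E3 → ℝ} (hg : Integrable g O.surfaceMeasure) (k : Fin O.N) :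
    IntegrableOn (fun w => g (O.chart k w)) (litParameters O k) := by
  have h := (integrable_finsetSum_measure.1 hg) k (Finset.mem_univ k)
  rw [(O.measurableEmbedding_chart k).integrable_map_iff] at h
  exact IntegrableOn.mono_set h (litParameters_subset_relint O k)

lemma integrableOn_image {g : E3 → ℝ} (hfront : ∀ x ∈ O.carrier, 0 < x 2)
    (hg : Integrable g O.surfaceMeasure) (k : Fin O.N) :
    IntegrableOn (C.integrand O g) (C.faceProj O k '' litParameters O k) := by
  have hA := measurableSet_litParameters hfront k
  rw [integrableOn_image_iff_integrableOn_abs_det_fderiv_smul volume hA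
    (C.hasFDerivWithinAt_faceProj hfront k) (C.injOn_faceProj hfront k)]
  have hsub : litParameters O k ⊆ frontDomain O k :=
    (litParameters_subset O k).trans (preimage_face_subset_frontDomain hfront k)
  obtain ⟨M, hM⟩ := (isCompact_preimage_face O k).exists_bound_of_continuousOn
    ((C.continuousOn_det_faceProj O k).mono (preimage_face_subset_frontDomain hfront k))
  have h1 : IntegrableOn (fun w => (|(fderiv ℝ (C.faceProj O k) w).det| *
      C.cosAngle (C.faceProj O k w) ^ 4) * g (O.chart k w)) (litParameters O k) := by
    refine Integrable.bdd_mul (c := M) (integrableOn_chart hg k) ?_ ?_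
    · refine AEStronglyMeasurable.mul ?_ ?_
      · exact ((C.continuousOn_det_faceProj O k).mono hsub).abs.aestronglyMeasurable hA
      · have h2 : AEMeasurable (C.faceProj O k) (volume.restrict (litParameters O k)) :=
          ((C.contDiffOn_faceProj O k).continuousOn.mono hsub).aemeasurable hA
        exact ((C.measurable_cosAngle.pow_const 4).comp_aemeasurable h2).aestronglyMeasurable
    · refine (ae_restrict_iff' hA).2 (ae_of_all _ fun w hw => ?_)
      rw [norm_mul, Real.norm_eq_abs, abs_abs]
      exact (mul_le_of_le_one_right (abs_nonneg _) (C.norm_cosAngle_pow_le _)).trans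
        (hM w (litParameters_subset O k hw))
  refine h1.congr_fun (fun w hw => ?_) hA
  beta_reduce
  rw [integrand, C.projInv_faceProj hfront k hw, smul_eq_mul]
  ring

/-- The integrand of the sensor model is absolutely integrable. -/
theorem integrableOn_integrand {g : E3 → ℝ} (hfront : ∀ x ∈ O.carrier, 0 < x 2)
    (hg : Integrable g O.surfaceMeasure) (i : Fin m) :
    IntegrableOn (C.integrand O g) (C.litPixel O i) := by
  obtain ⟨Z, hZ, hcover⟩ := C.exists_null_cover hfront
  refine IntegrableOn.mono_set ?_ (inter_subset_right.trans hcover)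
  refine IntegrableOn.union ?_ (IntegrableOn.of_measure_zero hZ)
  exact integrableOn_finite_iUnion.2 fun k => C.integrableOn_image hfront hg k

/-- The image of a radiosity depends continuously on it in the mean. -/
theorem exists_lintegral_integrand_le (hfront : ∀ x ∈ O.carrier, 0 < x 2) :
    ∃ M : NNReal, ∀ (g : E3 → ℝ) (i : Fin m),
      Integrable g O.surfaceMeasure →
      ∫⁻ z in C.litPixel O i, ‖C.integrand O g z‖ₑ ≤ M * ∫⁻ x, ‖g x‖ₑ ∂O.surfaceMeasure := by
  have hM : ∀ k, ∃ M : ℝ, ∀ w ∈ O.chart k ⁻¹' O.face k,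
      ‖(fderiv ℝ (C.faceProj O k) w).det‖ ≤ M := fun k =>
    (isCompact_preimage_face O k).exists_bound_of_continuousOn
      ((C.continuousOn_det_faceProj O k).mono (preimage_face_subset_frontDomain hfront k))
  choose M hM using hM
  set K : NNReal := ∑ k, (M k).toNNReal with hK
  have hMK : ∀ k, M k ≤ K := fun k => by
    have h1 : (M k).toNNReal ≤ K :=
      Finset.single_le_sum (f := fun k => (M k).toNNReal) (fun _ _ => zero_le) (Finset.mem_univ k)
    exact (Real.le_coe_toNNReal _).trans (NNReal.coe_le_coe.2 h1)
  refine ⟨K, fun g i hg => ?_⟩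
  obtain ⟨Z, hZ, hcover⟩ := C.exists_null_cover hfront
  have himage : ∀ k, ∫⁻ z in C.faceProj O k '' litParameters O k, ‖C.integrand O g z‖ₑ ≤
      K * ∫⁻ w in O.chart k ⁻¹' intrinsicInterior ℝ (O.face k), ‖g (O.chart k w)‖ₑ := by
    intro k
    have hA := measurableSet_litParameters hfront k
    rw [lintegral_image_eq_lintegral_abs_det_fderiv_mul volume hA
      (C.hasFDerivWithinAt_faceProj hfront k) (C.injOn_faceProj hfront k),
      ← lintegral_const_mul' _ _ ENNReal.coe_ne_top]
    refine (setLIntegral_mono' hA fun w hw => ?_).trans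
      (lintegral_mono_set (litParameters_subset_relint O k))
    refine mul_le_mul' ?_ ?_
    · rw [← ENNReal.ofReal_coe_nnreal]
      exact ENNReal.ofReal_le_ofReal ((hM k w (litParameters_subset O k hw)).trans (hMK k))
    · rw [integrand, C.projInv_faceProj hfront k hw, enorm_mul]
      refine mul_le_of_le_one_right' ?_
      rw [← enorm_one (G := ℝ)]
      exact enorm_le_iff_norm_le.2 (by simpa using C.norm_cosAngle_pow_le _)
  calc ∫⁻ z in C.litPixel O i, ‖C.integrand O g z‖ₑ
      ≤ ∫⁻ z in (⋃ k, C.faceProj O k '' litParameters O k) ∪ Z, ‖C.integrand O g z‖ₑ :=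
        lintegral_mono_set (inter_subset_right.trans hcover)
    _ ≤ ∫⁻ z in ⋃ k, C.faceProj O k '' litParameters O k, ‖C.integrand O g z‖ₑ := by
        refine (lintegral_union_le _ _ _).trans ?_
        rw [setLIntegral_measure_zero _ _ hZ, add_zero]
    _ ≤ ∑ k, ∫⁻ z in C.faceProj O k '' litParameters O k, ‖C.integrand O g z‖ₑ := by
        exact (lintegral_iUnion_le _ _).trans_eq (tsum_fintype _)
    _ ≤ ∑ k, K * ∫⁻ w in O.chart k ⁻¹' intrinsicInterior ℝ (O.face k), ‖g (O.chart k w)‖ₑ :=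
        Finset.sum_le_sum fun k _ => himage k
    _ = K * ∫⁻ x, ‖g x‖ₑ ∂O.surfaceMeasure := by
        rw [← Finset.mul_sum, TriangulatedObject.surfaceMeasure, lintegral_finsetSum_measure]
        exact congrArg _ (Finset.sum_congr rfl fun k _ =>
          ((O.measurableEmbedding_chart k).lintegral_map (fun x => ‖g x‖ₑ)).symm)

lemma integrand_add (g g' : E3 → ℝ) (z : E2) :
    C.integrand O (g + g') z = C.integrand O g z + C.integrand O g' z := add_mul _ _ _

lemma integrand_smul (c : ℝ) (g : E3 → ℝ) (z : E2) :
    C.integrand O (c • g) z = c * C.integrand O g z := mul_assoc _ _ _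

lemma sensor_apply (g : E3 → ℝ) (i : Fin m) : C.sensor O g i =
    C.gain / 4 * (C.lens / C.focal) ^ 2 * ∫ z in C.litPixel O i, C.integrand O g z := rfl

lemma sensor_add (hfront : ∀ x ∈ O.carrier, 0 < x 2) {g g' : E3 → ℝ}
    (hg : Integrable g O.surfaceMeasure) (hg' : Integrable g' O.surfaceMeasure) (i : Fin m) :
    C.sensor O (g + g') i = C.sensor O g i + C.sensor O g' i := by
  simp only [sensor_apply, integrand_add]
  rw [integral_add (C.integrableOn_integrand hfront hg i) (C.integrableOn_integrand hfront hg' i),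
    mul_add]

lemma sensor_smul (c : ℝ) (g : E3 → ℝ) (i : Fin m) :
    C.sensor O (c • g) i = c * C.sensor O g i := by
  simp only [sensor_apply, integrand_smul]
  rw [integral_const_mul]
  ring

lemma exists_norm_sensor_le (hfront : ∀ x ∈ O.carrier, 0 < x 2) :
    ∃ K : ℝ, 0 ≤ K ∧ ∀ (g : E3 → ℝ) (i : Fin m), Integrable g O.surfaceMeasure →
      ‖C.sensor O g i‖ ≤ K * ∫ x, ‖g x‖ ∂O.surfaceMeasure := by
  obtain ⟨M, hM⟩ := C.exists_lintegral_integrand_le hfront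
  refine ⟨‖C.gain / 4 * (C.lens / C.focal) ^ 2‖ * M, by positivity, fun g i hg => ?_⟩
  rw [sensor_apply, norm_mul, mul_assoc]
  refine mul_le_mul_of_nonneg_left ?_ (norm_nonneg _)
  refine (norm_integral_le_integral_norm _).trans ?_
  rw [integral_norm_eq_lintegral_enorm (C.integrableOn_integrand hfront hg i).aestronglyMeasurable,
    integral_norm_eq_lintegral_enorm hg.aestronglyMeasurable, ← ENNReal.coe_toReal,
    ← ENNReal.toReal_mul]
  exact ENNReal.toReal_mono (ENNReal.mul_ne_top ENNReal.coe_ne_top hg.2.ne) (hM g i hg)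

lemma sensor_congr (hfront : ∀ x ∈ O.carrier, 0 < x 2) {g g' : E3 → ℝ}
    (hg : Integrable g O.surfaceMeasure) (h : g =ᵐ[O.surfaceMeasure] g') (i : Fin m) :
    C.sensor O g i = C.sensor O g' i := by
  obtain ⟨K, -, hK⟩ := C.exists_norm_sensor_le hfront
  have hd : Integrable ((-1 : ℝ) • g') O.surfaceMeasure := (hg.congr h).smul _
  have h1 := hK (g + (-1 : ℝ) • g') i (hg.add hd)
  have h2 : ∫ x, ‖(g + (-1 : ℝ) • g') x‖ ∂O.surfaceMeasure = 0 := by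
    rw [← integral_zero E3 ℝ (μ := O.surfaceMeasure)]
    refine integral_congr_ae ?_
    filter_upwards [h] with x hx
    simp [hx]
  rw [h2, mul_zero, norm_le_zero_iff, C.sensor_add hfront hg hd, sensor_smul] at h1
  linarith

/-- The sensor as a continuous linear functional on the Hilbert space. -/
lemma exists_sensorLp (hfront : ∀ x ∈ O.carrier, 0 < x 2) (i : Fin m) :
    ∃ L : Lp ℝ 2 O.surfaceMeasure →L[ℝ] ℝ, ∀ g : Lp ℝ 2 O.surfaceMeasure, L g = C.sensor O g i := by
  obtain ⟨K, hK0, hK⟩ := C.exists_norm_sensor_le hfront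
  have hint (g : Lp ℝ 2 O.surfaceMeasure) : Integrable g O.surfaceMeasure :=
    (Lp.memLp g).integrable one_le_two
  set V : ℝ := (O.surfaceMeasure univ ^ (1 / (1 : ℝ≥0∞).toReal - 1 / (2 : ℝ≥0∞).toReal)).toReal
  refine ⟨LinearMap.mkContinuous
    { toFun := fun g => C.sensor O g i
      map_add' := fun g g' => ?_
      map_smul' := fun c g => ?_ } (K * V) fun g => ?_, fun g => rfl⟩
  · rw [C.sensor_congr hfront (hint _) (Lp.coeFn_add g g'), C.sensor_add hfront (hint _) (hint _)]
  · rw [C.sensor_congr hfront (hint _) (Lp.coeFn_smul c g), sensor_smul]; rfl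
  · refine (hK g i (hint g)).trans ?_
    rw [mul_assoc]
    refine mul_le_mul_of_nonneg_left ?_ hK0
    rw [integral_norm_eq_lintegral_enorm (hint g).aestronglyMeasurable,
      ← eLpNorm_one_eq_lintegral_enorm, Lp.norm_def, mul_comm, ← ENNReal.toReal_mul]
    refine ENNReal.toReal_mono (ENNReal.mul_ne_top (Lp.eLpNorm_ne_top g) ?_)
      (eLpNorm_le_eLpNorm_mul_rpow_measure_univ one_le_two (Lp.aestronglyMeasurable g))
    exact ENNReal.rpow_ne_top_of_nonneg (by norm_num) (measure_ne_top _ _)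

/-- Each pixel value of the resolvent is the inner product with a fixed square-integrable
function (the adjoint response of the pixel). -/
theorem exists_pixel_response {ρ : E3 → ℝ} (hρ : O.IsAlbedo ρ)
    (hT : O.interreflectionNorm ρ < 1) (hfront : ∀ x ∈ O.carrier, 0 < x 2) (i : Fin m) :
    ∃ h : E3 → ℝ, Integrable h O.surfaceMeasure ∧ ∀ g ∈ O.L2,
      C.sensor O (O.resolvent ρ g) i = ∫ x, h x * g x ∂O.surfaceMeasure := by
  obtain ⟨L, hL⟩ := C.exists_sensorLp hfront i
  set φ := (InnerProductSpace.toDual ℝ (Lp ℝ 2 O.surfaceMeasure)).symm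
    (L.comp (O.resolventLp hρ hT)) with hφ
  refine ⟨φ, (Lp.memLp φ).integrable one_le_two, fun g hg => ?_⟩
  have hg : MemLp g 2 O.surfaceMeasure := hg
  have h1 : C.sensor O (O.resolvent ρ g) i = L (O.resolventLp hρ hT (MemLp.toLp g hg)) := by
    have hr := O.memLp_resolvent hρ hT hg
    rw [← O.toLp_resolvent hρ hT hg, hL]
    exact C.sensor_congr hfront (hr.integrable one_le_two) (MemLp.coeFn_toLp hr).symm i
  have h2 : L (O.resolventLp hρ hT (MemLp.toLp g hg)) = inner ℝ φ (MemLp.toLp g hg) := by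
    rw [hφ, InnerProductSpace.toDual_symm_apply]; rfl
  rw [h1, h2, L2.inner_def]
  refine integral_congr_ae ?_
  filter_upwards [MemLp.coeFn_toLp hg] with x hx
  rw [hx]
  simp [mul_comm]

end Camera

namespace TriangulatedObject

variable (O : TriangulatedObject) {ρ : E3 → ℝ}

/-! ### Superposition -/

/-- Weak continuity of the direct reflectance in the direction. -/
lemma continuous_integral_mul_pointDirect (hρ : O.IsAlbedo ρ) {h : E3 → ℝ}
    (hh : Integrable h O.surfaceMeasure) :
    Continuous fun u => ∫ x, h x * O.pointDirect ρ u x ∂O.surfaceMeasure := by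
  refine continuous_iff_continuousAt.2 fun u => ?_
  refine tendsto_integral_filter_of_dominated_convergence (fun x => ‖h x‖)
    (Filter.Eventually.of_forall fun v => hh.aestronglyMeasurable.mul
      (O.aemeasurable_pointDirect hρ v).aestronglyMeasurable)
    (Filter.Eventually.of_forall fun v => ae_of_all _ fun x => ?_) hh.norm ?_
  · rw [norm_mul]
    exact mul_le_of_le_one_right (norm_nonneg _) (O.norm_pointDirect_le hρ v x)
  · filter_upwards [O.ae_continuousAt_pointDirect ρ u] with x hx
    exact hx.tendsto.const_mul _

/-- Exchange of the integrations over the boundary and over the directions. -/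
lemma integral_mul_direct (hρ : O.IsAlbedo ρ) {h : E3 → ℝ} (hh : Integrable h O.surfaceMeasure)
    {f : S2 → ℝ} (hf : Integrable f sphereMeasure) :
    ∫ x, h x * O.direct ρ f x ∂O.surfaceMeasure =
      ∫ u, (∫ x, h x * O.pointDirect ρ u x ∂O.surfaceMeasure) * f u ∂sphereMeasure := by
  have hint : Integrable (Function.uncurry fun (x : E3) (u : S2) =>
      O.pointDirect ρ u x * (h x * f u)) (O.surfaceMeasure.prod sphereMeasure) :=
    (hh.mul_prod hf).bdd_mul (O.aemeasurable_pointDirect_prod hρ).aestronglyMeasurable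
      (ae_of_all _ fun p => O.norm_pointDirect_le hρ p.2 p.1)
  calc ∫ x, h x * O.direct ρ f x ∂O.surfaceMeasure
      = ∫ x, ∫ u, O.pointDirect ρ u x * (h x * f u) ∂sphereMeasure ∂O.surfaceMeasure := by
        refine integral_congr_ae (ae_of_all _ fun x => ?_)
        beta_reduce
        rw [direct, ← integral_const_mul]
        exact integral_congr_ae (ae_of_all _ fun u => by ring)
    _ = ∫ u, ∫ x, O.pointDirect ρ u x * (h x * f u) ∂O.surfaceMeasure ∂sphereMeasure :=
        integral_integral_swap hint
    _ = _ := by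
        refine integral_congr_ae (ae_of_all _ fun u => ?_)
        beta_reduce
        rw [← integral_mul_const]
        exact integral_congr_ae (ae_of_all _ fun x => by ring)

end TriangulatedObject

/-- A Riemann integrable function on the sphere is integrable for the spherical measure. -/
lemma SphereRiemannIntegrable.integrable {f : S2 → ℝ} (hf : SphereRiemannIntegrable f) :
    Integrable f sphereMeasure := by
  obtain ⟨a, ha⟩ := hf
  exact (SphericalCoordinates.integrable_sphere_iff f).2 (RiemannBox.integrableOn ha)

/-- The product of a continuous and a Riemann integrable function on the sphere is Riemann
integrable, and its Riemann integral is its Lebesgue integral. -/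
lemma SphereRiemannIntegrable.hasSphereRiemannIntegral_mul {f Y : S2 → ℝ}
    (hf : SphereRiemannIntegrable f) (hY : Continuous Y) :
    HasSphereRiemannIntegral (fun u => Y u * f u) (∫ u, Y u * f u ∂sphereMeasure) := by
  obtain ⟨B, hB⟩ := (isCompact_univ (X := S2)).exists_bound_of_continuousOn hY.continuousOn
  have hint : Integrable (fun u => Y u * f u) sphereMeasure :=
    hf.integrable.bdd_mul hY.measurable.aestronglyMeasurable (ae_of_all _ fun u => hB u trivial)
  obtain ⟨a, ha⟩ := hf
  have h := RiemannBox.hasIntegral_mul_of_continuous ha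
    (hY.comp SphericalCoordinates.continuous_sphCoord)
  rw [SphericalCoordinates.integral_sphere hint, HasSphereRiemannIntegral]
  simp only [mul_assoc]
  exact h

end

theorem lemma4p1 {m : ℕ} (O : TriangulatedObject) (ρ : E3 → ℝ) (hρ : O.IsAlbedo ρ)
    (C : Camera m) (hfront : ∀ x ∈ O.carrier, 0 < x 2)
    (hT : O.interreflectionNorm ρ < 1) :
    Set.BijOn (O.idSubInterreflection ρ) O.L2 O.L2 ∧
    (∀ g ∈ O.L2, ∀ i, MeasureTheory.IntegrableOn (C.integrand O g) (C.litPixel O i)) ∧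
    (∀ u, O.pointDirect ρ u ∈ O.L2) ∧
    ∀ f : S2 → ℝ, SphereRiemannIntegrable f →
      (∀ x, MeasureTheory.Integrable (fun u => O.pointDirect ρ u x * f u) sphereMeasure) ∧
      O.direct ρ f ∈ O.L2 ∧
      ∀ i, HasSphereRiemannIntegral (fun u => C.pointImage O ρ u i * f u) (C.image O ρ f i) := by
  refine ⟨O.bijOn_idSubInterreflection hρ hT,
    fun g hg i => C.integrableOn_integrand hfront (O.integrable_of_memLp hg) i,
    O.pointDirect_mem_L2 hρ, fun f hf => ?_⟩
  have hfi := hf.integrable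
  have hD := O.direct_mem_L2 hρ hfi
  refine ⟨O.integrable_pointDirect_mul hρ hfi, hD, fun i => ?_⟩
  obtain ⟨h, hh, hrep⟩ := C.exists_pixel_response hρ hT hfront i
  have hpoint : (fun u => C.pointImage O ρ u i * f u) =
      fun u => (∫ x, h x * O.pointDirect ρ u x ∂O.surfaceMeasure) * f u :=
    funext fun u => congrArg (· * f u) (hrep _ (O.pointDirect_mem_L2 hρ u))
  have himage : C.image O ρ f i =
      ∫ u, (∫ x, h x * O.pointDirect ρ u x ∂O.surfaceMeasure) * f u ∂sphereMeasure :=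
    (hrep _ hD).trans (O.integral_mul_direct hρ hh hfi)
  rw [hpoint, himage]
  exact hf.hasSphereRiemannIntegral_mul (O.continuous_integral_mul_pointDirect hρ hh)
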